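/- Let $U\subseteq\mathbb R^2$ be open and let $A_0,A_1,A_2,B_0,\dots,B_7$ be $C^\infty$ functions of $(x,y)\in U$ with $A_2\neq 0$ on $U$. Consider the fourth-order equation $$y''''+(A_2y'^2-A_1y'+A_0)y'''+B_7y'^7-B_6y'^6+B_5y'^5-B_4y'^4+B_3y'^3-B_2y'^2+B_1y'-B_0=0 \qquad (\ast)$$ and define $$c=\tfrac{A_2}{3},\quad g=\tfrac{A_1}{2},\quad h=A_0,$$ $$d=\frac{1}{4cA_2}\Big(B_4-8cA_1A_0-\tfrac14A_1^3+3A_1c_x-7A_0c_y+2cA_{1x}-\tfrac54A_1A_{1y}-3cA_{0y}+2c_{xy}-\tfrac12A_{1yy}\Big).$$ Suppose that on $U$ the constraints $$B_7=6c^3,\qquad B_6=7c(cA_1+c_y),\qquad B_5=4cA_2A_0+\tfrac52cA_1^2-6cc_x+\tfrac72A_1c_y+\tfrac52cA_{1y}+c_{yy},$$ $$B_3=8cA_1d+6cA_0^2+A_1^2A_0-6A_0c_x+7dc_y-A_1A_{1x}+\tfrac52A_0A_{1y}-2cA_{0x}+\tfrac32A_1A_{0y}+cd_y+c_{xx}-A_{1xy}+A_{0yy},$$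 $$B_2=12cA_0d+A_1^2d+A_1A_0^2-6dc_x-2A_0A_{1x}+\tfrac52dA_{1y}-A_1A_{0x}+3A_0A_{0y}+\tfrac12A_1d_y+\tfrac12A_{1xx}-2A_{0xy}+d_{yy},$$ $$B_1=6cd^2+2A_1A_0d-2dA_{1x}-2A_0A_{0x}+3dA_{0y}+A_0d_y+A_{0xx}-2d_{xy},$$ $$B_0=d(A_1d+d_y-2A_{0x})+d_{xx}$$ hold, together with Lie's linearizability criteria $$3(ch)_x+3dc_y+6cd_y-2gg_x-gh_y-3c_{xx}-2g_{xy}-h_{yy}=0,$$ $$3(dg)_y+3cd_x+6dc_x-2hh_y-hg_x-3d_{yy}-2h_{xy}-g_{xx}=0.$$ Then $(\ast)$ is linearizable conditionally on the root equation $$E[y]:=y''+cy'^3-gy'^2+hy'-d=0,$$ that is: 1. $(\ast)$ arises from the twice-differentiated root equation by substituting the root equation for $y''$: for every $C^4$ function $y$ on an open set with graph in $U$, at every $x$ with $E[y](x)=0$ the left-hand side of $(\ast)$ equals $\frac{d^2}{dx^2}E[y](x)$. Every $C^2$ solution of the root equation is a ($C^4$) solution of $(\ast)$. 2. Every point of $U$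 has an open neighbourhood $V\subseteq U$ with an invertible smooth point transformation $t=X(x,y)$, $u=Y(x,y)$ (injective, with nowhere vanishing Jacobian) that carries the root equation into the linear equation $u_{tt}=0$: for $C^2$ functions $y$ with graph in $V$ and $\frac{d}{dx}X(x,y(x))\neq0$, whose graph is carried to the graph of $u$, one has $E[y](x)=0$ if and only if $u_{tt}=0$ at $t=X(x,y(x))$; and, over intervals, the solutions of the root equation with graph in $V$ are exactly the $C^2$ functions $y$ with $kX(x,y(x))+lY(x,y(x))=m$ for some constants $k,l,m$, $(k,l)\neq(0,0)$. 3. Metric consistency. Call smooth functions $a,b,e,f,p,q,r$ on an open $W\subseteq U$ consistent if $h=a-2e$, $g=f-2b$, $pr-q^2\neq0$, the connection with Christoffel symbols $\Gamma^1_{11}=-a$, $\Gamma^1_{12}=-b$, $\Gamma^1_{22}=-c$, $\Gamma^2_{11}=-d$, $\Gamma^2_{12}=-e$, $\Gamma^2_{22}=-f$ is flat, i.e. $$a_y-b_x+be-cd=0,\quad b_y-c_x+(ac-b^2)+(bf-ce)=0,\quad d_y-e_x-(ae-bd)-(df-e^2)=0,\quad (b+f)_x=(a+e)_y,$$ and these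 are the Christoffel symbols of the metric $p\,dx^2+2q\,dx\,dy+r\,dy^2$, i.e. $$p_x=-2(ap+dq),\quad q_x=-bp-(a+e)q-dr,\quad r_x=-2(bq+er),$$ $$p_y=-2(bp+eq),\quad q_y=-cp-(b+f)q-er,\quad r_y=-2(cq+fr).$$ Every point of $U$ has an open neighbourhood $W\subseteq U$ on which consistent functions exist; and for every open $W\subseteq U$ and every consistent choice on $W$, each point of $W$ has an open neighbourhood $V\subseteq W$ with Cartesian coordinates $X,Y$ for that metric (the metric is $\pm dX^2\pm dY^2$ on $V$), and $(X,Y)$ linearizes the root equation on $V$ in the sense of 2. -/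

import Mathlib

open Set
open scoped ContDiff

noncomputable section

namespace CondLin

/-- Partial derivative in the first variable of a function of `(x, y)`. -/
def px (F : ℝ × ℝ → ℝ) : ℝ × ℝ → ℝ := fun z => deriv (fun s => F (s, z.2)) z.1

/-- Partial derivative in the second variable of a function of `(x, y)`. -/
def py (F : ℝ × ℝ → ℝ) : ℝ × ℝ → ℝ := fun z => deriv (fun s => F (z.1, s)) z.2

/-- `F` is infinitely differentiable on `U`. -/
def Smooth (F : ℝ × ℝ → ℝ) (U : Set (ℝ × ℝ)) : Prop := ContDiffOn ℝ ∞ F U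

/-- The graph of `y` over `I` lies in `U`. -/
def GraphIn (y : ℝ → ℝ) (I : Set ℝ) (U : Set (ℝ × ℝ)) : Prop := ∀ x ∈ I, (x, y x) ∈ U

/-- Coefficients of a cubically semi-linear second order equation
`y_xx + c y_x^3 - g y_x^2 + h y_x - d = 0`. -/
structure Root where
  c : ℝ × ℝ → ℝ
  g : ℝ × ℝ → ℝ
  h : ℝ × ℝ → ℝ
  d : ℝ × ℝ → ℝ

/-- Coefficients of a fourth order equation
`y_xxxx + (A2 y_x^2 - A1 y_x + A0) y_xxx + B7 y_x^7 - B6 y_x^6 + B5 y_x^5 - B4 y_x^4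
  + B3 y_x^3 - B2 y_x^2 + B1 y_x - B0 = 0`. -/
structure FourthOrder where
  A0 : ℝ × ℝ → ℝ
  A1 : ℝ × ℝ → ℝ
  A2 : ℝ × ℝ → ℝ
  B0 : ℝ × ℝ → ℝ
  B1 : ℝ × ℝ → ℝ
  B2 : ℝ × ℝ → ℝ
  B3 : ℝ × ℝ → ℝ
  B4 : ℝ × ℝ → ℝ
  B5 : ℝ × ℝ → ℝ
  B6 : ℝ × ℝ → ℝ
  B7 : ℝ × ℝ → ℝ

/-- Left-hand side of the second order equation, evaluated along `y` at `x`. -/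
def Root.lhs (R : Root) (y : ℝ → ℝ) (x : ℝ) : ℝ :=
  iteratedDeriv 2 y x + R.c (x, y x) * deriv y x ^ 3 - R.g (x, y x) * deriv y x ^ 2
    + R.h (x, y x) * deriv y x - R.d (x, y x)

/-- `y` is a (classical) solution on `I` of the second order equation considered on `U`. -/
def Root.IsSolution (R : Root) (U : Set (ℝ × ℝ)) (I : Set ℝ) (y : ℝ → ℝ) : Prop :=
  ContDiffOn ℝ 2 y I ∧ GraphIn y I U ∧ ∀ x ∈ I, R.lhs y x = 0

/-- Left-hand side of the fourth order equation, evaluated along `y` at `x`. -/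
def FourthOrder.lhs (Q : FourthOrder) (y : ℝ → ℝ) (x : ℝ) : ℝ :=
  iteratedDeriv 4 y x
    + (Q.A2 (x, y x) * deriv y x ^ 2 - Q.A1 (x, y x) * deriv y x + Q.A0 (x, y x))
        * iteratedDeriv 3 y x
    + Q.B7 (x, y x) * deriv y x ^ 7 - Q.B6 (x, y x) * deriv y x ^ 6
    + Q.B5 (x, y x) * deriv y x ^ 5 - Q.B4 (x, y x) * deriv y x ^ 4
    + Q.B3 (x, y x) * deriv y x ^ 3 - Q.B2 (x, y x) * deriv y x ^ 2
    + Q.B1 (x, y x) * deriv y x - Q.B0 (x, y x)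

/-- `y` is a (classical) solution on `I` of the fourth order equation considered on `U`. -/
def FourthOrder.IsSolution (Q : FourthOrder) (U : Set (ℝ × ℝ)) (I : Set ℝ) (y : ℝ → ℝ) : Prop :=
  ContDiffOn ℝ 4 y I ∧ GraphIn y I U ∧ ∀ x ∈ I, Q.lhs y x = 0

/-- All coefficients of the fourth order equation are smooth on `U`. -/
def FourthOrder.SmoothOn (Q : FourthOrder) (U : Set (ℝ × ℝ)) : Prop :=
  Smooth Q.A0 U ∧ Smooth Q.A1 U ∧ Smooth Q.A2 U ∧ Smooth Q.B0 U ∧ Smooth Q.B1 U ∧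
  Smooth Q.B2 U ∧ Smooth Q.B3 U ∧ Smooth Q.B4 U ∧ Smooth Q.B5 U ∧ Smooth Q.B6 U ∧ Smooth Q.B7 U

/-- The root coefficient `c` read off from the fourth order equation. -/
def FourthOrder.c (Q : FourthOrder) : ℝ × ℝ → ℝ := fun z => Q.A2 z / 3

/-- The root coefficient `d` read off from the fourth order equation
(meaningful where `A2` does not vanish). -/
def FourthOrder.d (Q : FourthOrder) : ℝ × ℝ → ℝ := fun z =>
  (Q.B4 z - 8 * Q.c z * Q.A1 z * Q.A0 z - Q.A1 z ^ 3 / 4 + 3 * Q.A1 z * px Q.c z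
    - 7 * Q.A0 z * py Q.c z + 2 * Q.c z * px Q.A1 z - 5 / 4 * Q.A1 z * py Q.A1 z
    - 3 * Q.c z * py Q.A0 z + 2 * py (px Q.c) z - py (py Q.A1) z / 2) / (4 * Q.c z * Q.A2 z)

/-- The root equation whose four coefficients are identified from the fourth order equation. -/
def FourthOrder.root (Q : FourthOrder) : Root where
  c := Q.c
  g := fun z => Q.A1 z / 2
  h := Q.A0
  d := Q.d

/-- The differential constraints on the remaining coefficients, on `U`. -/
structure FourthOrder.Constraints (Q : FourthOrder) (U : Set (ℝ × ℝ)) : Prop where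
  b7 : ∀ z ∈ U, Q.B7 z = 6 * Q.c z ^ 3
  b6 : ∀ z ∈ U, Q.B6 z = 7 * Q.c z * (Q.c z * Q.A1 z + py Q.c z)
  b5 : ∀ z ∈ U, Q.B5 z = 4 * Q.c z * Q.A2 z * Q.A0 z + 5 / 2 * Q.c z * Q.A1 z ^ 2
    - 6 * Q.c z * px Q.c z + 7 / 2 * Q.A1 z * py Q.c z + 5 / 2 * Q.c z * py Q.A1 z
    + py (py Q.c) z
  b3 : ∀ z ∈ U, Q.B3 z = 8 * Q.c z * Q.A1 z * Q.d z + 6 * Q.c z * Q.A0 z ^ 2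
    + Q.A1 z ^ 2 * Q.A0 z - 6 * Q.A0 z * px Q.c z + 7 * Q.d z * py Q.c z - Q.A1 z * px Q.A1 z
    + 5 / 2 * Q.A0 z * py Q.A1 z - 2 * Q.c z * px Q.A0 z + 3 / 2 * Q.A1 z * py Q.A0 z
    + Q.c z * py Q.d z + px (px Q.c) z - py (px Q.A1) z + py (py Q.A0) z
  b2 : ∀ z ∈ U, Q.B2 z = 12 * Q.c z * Q.A0 z * Q.d z + Q.A1 z ^ 2 * Q.d z
    + Q.A1 z * Q.A0 z ^ 2 - 6 * Q.d z * px Q.c z - 2 * Q.A0 z * px Q.A1 z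
    + 5 / 2 * Q.d z * py Q.A1 z - Q.A1 z * px Q.A0 z + 3 * Q.A0 z * py Q.A0 z
    + Q.A1 z * py Q.d z / 2 + px (px Q.A1) z / 2 - 2 * py (px Q.A0) z + py (py Q.d) z
  b1 : ∀ z ∈ U, Q.B1 z = 6 * Q.c z * Q.d z ^ 2 + 2 * Q.A1 z * Q.A0 z * Q.d z
    - 2 * Q.d z * px Q.A1 z - 2 * Q.A0 z * px Q.A0 z + 3 * Q.d z * py Q.A0 z
    + Q.A0 z * py Q.d z + px (px Q.A0) z - 2 * py (px Q.d) z
  b0 : ∀ z ∈ U, Q.B0 z = Q.d z * (Q.A1 z * Q.d z + py Q.d z - 2 * px Q.A0 z) + px (px Q.d) z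

/-- Lie's linearizability criteria for the second order equation, on `U`. -/
structure Root.LieCriteria (R : Root) (U : Set (ℝ × ℝ)) : Prop where
  first : ∀ z ∈ U, 3 * px (fun w => R.c w * R.h w) z + 3 * R.d z * py R.c z
    + 6 * R.c z * py R.d z - 2 * R.g z * px R.g z - R.g z * py R.h z
    - 3 * px (px R.c) z - 2 * py (px R.g) z - py (py R.h) z = 0
  second : ∀ z ∈ U, 3 * py (fun w => R.d w * R.g w) z + 3 * R.c z * px R.d z
    + 6 * R.d z * px R.c z - 2 * R.h z * py R.h z - R.h z * px R.g z
    - 3 * py (py R.d) z - 2 * py (px R.h) z - px (px R.g) z = 0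

/-- The fourth order equation comes from the second derivative of the root equation by replacing
the second derivative of `y` through the root equation: at any single point where the root
expression vanishes along `y`, the fourth order expression equals the second derivative of the
root expression. (The root equation is required at `x` only, so the values there of the third and
fourth derivatives of `y` are unrestricted.) -/
def FourthOrder.ArisesFrom (Q : FourthOrder) (R : Root) (U : Set (ℝ × ℝ)) : Prop :=
  ∀ (I : Set ℝ) (y : ℝ → ℝ), IsOpen I → ContDiffOn ℝ 4 y I → GraphIn y I U →
    ∀ x ∈ I, R.lhs y x = 0 → Q.lhs y x = iteratedDeriv 2 (R.lhs y) x

/-- `t = X(x, y)`, `u = Y(x, y)` is an invertible smooth point transformation on `V`. -/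
structure IsPointTransformation (X Y : ℝ × ℝ → ℝ) (V : Set (ℝ × ℝ)) : Prop where
  smooth_X : Smooth X V
  smooth_Y : Smooth Y V
  inj : InjOn (fun z => (X z, Y z)) V
  jacobian : ∀ z ∈ V, px X z * py Y z - py X z * px Y z ≠ 0

/-- The point transformation `t = X(x, y)`, `u = Y(x, y)` on `V` carries the second order equation
into the linear equation `u_tt = 0`. -/
structure Root.LinearizedBy (R : Root) (X Y : ℝ × ℝ → ℝ) (V : Set (ℝ × ℝ)) : Prop where
  point : IsPointTransformation X Y V
  /-- whenever the transformed graph of `y` is the graph of a function `u` of `t`, the equation for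
  `y` holds at a point exactly if `u_tt` vanishes at the corresponding point -/
  equiv : ∀ (I : Set ℝ) (y u : ℝ → ℝ), IsOpen I → ContDiffOn ℝ 2 y I → GraphIn y I V →
    (∀ x ∈ I, deriv (fun s => X (s, y s)) x ≠ 0) →
    (∀ x ∈ I, u (X (x, y x)) = Y (x, y x)) →
    ∀ x ∈ I, R.lhs y x = 0 ↔ iteratedDeriv 2 u (X (x, y x)) = 0
  /-- the general solution: the graphs of solutions are exactly those carried into a line -/
  lines : ∀ (I : Set ℝ) (y : ℝ → ℝ), IsOpen I → IsPreconnected I → ContDiffOn ℝ 2 y I →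
    GraphIn y I V →
    ((∀ x ∈ I, R.lhs y x = 0) ↔
      ∃ k l m : ℝ, (k ≠ 0 ∨ l ≠ 0) ∧ ∀ x ∈ I, k * X (x, y x) + l * Y (x, y x) = m)

/-- The fourth order equation is linearizable conditionally on the second order equation `R`:
it arises from `R`, every solution of `R` solves it, and `R` is linearizable by a point
transformation near every point of `U`. -/
structure FourthOrder.ConditionallyLinearizable (Q : FourthOrder) (R : Root) (U : Set (ℝ × ℝ)) :
    Prop where
  arises : Q.ArisesFrom R U
  solutions : ∀ (I : Set ℝ) (y : ℝ → ℝ), IsOpen I → R.IsSolution U I y → Q.IsSolution U I y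
  linearizable : ∀ z ∈ U, ∃ (V : Set (ℝ × ℝ)) (X Y : ℝ × ℝ → ℝ),
    IsOpen V ∧ z ∈ V ∧ V ⊆ U ∧ R.LinearizedBy X Y V

/-- The remaining coefficients `a, b, e, f` of a system of geodesic type
`x_ss = a x_s^2 + 2 b x_s y_s + c y_s^2`, `y_ss = d x_s^2 + 2 e x_s y_s + f y_s^2`
(the negatives of Christoffel symbols) with metric `p dx^2 + 2 q dx dy + r dy^2`. -/
structure Geometry where
  a : ℝ × ℝ → ℝ
  b : ℝ × ℝ → ℝ
  e : ℝ × ℝ → ℝ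
  f : ℝ × ℝ → ℝ
  p : ℝ × ℝ → ℝ
  q : ℝ × ℝ → ℝ
  r : ℝ × ℝ → ℝ

/-- On `W`, the geodesic system with coefficients `a, b, c, d, e, f` projects to the second order
equation `R`, has zero curvature, and its Christoffel symbols are those of the nondegenerate
metric with coefficients `p, q, r`. -/
structure Geometry.Consistent (G : Geometry) (R : Root) (W : Set (ℝ × ℝ)) : Prop where
  smooth : Smooth G.a W ∧ Smooth G.b W ∧ Smooth G.e W ∧ Smooth G.f W ∧
    Smooth G.p W ∧ Smooth G.q W ∧ Smooth G.r W
  proj_h : ∀ z ∈ W, R.h z = G.a z - 2 * G.e z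
  proj_g : ∀ z ∈ W, R.g z = G.f z - 2 * G.b z
  flat1 : ∀ z ∈ W, py G.a z - px G.b z + G.b z * G.e z - R.c z * R.d z = 0
  flat2 : ∀ z ∈ W, py G.b z - px R.c z + (G.a z * R.c z - G.b z ^ 2)
    + (G.b z * G.f z - R.c z * G.e z) = 0
  flat3 : ∀ z ∈ W, py R.d z - px G.e z - (G.a z * G.e z - G.b z * R.d z)
    - (R.d z * G.f z - G.e z ^ 2) = 0
  flat4 : ∀ z ∈ W, px (fun w => G.b w + G.f w) z = py (fun w => G.a w + G.e w) z
  p_x : ∀ z ∈ W, px G.p z = -2 * (G.a z * G.p z + R.d z * G.q z)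
  q_x : ∀ z ∈ W, px G.q z = -(G.b z * G.p z) - (G.a z + G.e z) * G.q z - R.d z * G.r z
  r_x : ∀ z ∈ W, px G.r z = -2 * (G.b z * G.q z + G.e z * G.r z)
  p_y : ∀ z ∈ W, py G.p z = -2 * (G.b z * G.p z + G.e z * G.q z)
  q_y : ∀ z ∈ W, py G.q z = -(R.c z * G.p z) - (G.b z + G.f z) * G.q z - G.e z * G.r z
  r_y : ∀ z ∈ W, py G.r z = -2 * (R.c z * G.q z + G.f z * G.r z)
  nondeg : ∀ z ∈ W, G.p z * G.r z - G.q z ^ 2 ≠ 0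

/-- `X, Y` are Cartesian coordinates on `V` for the metric: it equals `± dX^2 ± dY^2`. -/
def Geometry.IsCartesian (G : Geometry) (X Y : ℝ × ℝ → ℝ) (V : Set (ℝ × ℝ)) : Prop :=
  ∃ s t : ℝ, (s = 1 ∨ s = -1) ∧ (t = 1 ∨ t = -1) ∧ ∀ z ∈ V,
    G.p z = s * px X z ^ 2 + t * px Y z ^ 2 ∧
    G.q z = s * (px X z * py X z) + t * (px Y z * py Y z) ∧
    G.r z = s * py X z ^ 2 + t * py Y z ^ 2

end CondLin

end

/-!
With `a = h + 2 e` and `f = g + 2 b`, the root equation describes the unparametrized geodesics of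
the connection with Christoffel symbols `-a, …, -f`, whatever `b` and `e` are. Flatness of this
connection is a total differential system for `(b, e)`, and its Frobenius compatibility conditions
are exactly Lie's criteria. A flat connection has, again by Frobenius, local coordinates `X, Y` with
vanishing covariant Hessian. Along a graph the velocity of such a function satisfies a linear first
order equation whose inhomogeneity is the root expression, so that `u_tt` is the root expression
times the Jacobian of `(X, Y)` over the cube of the velocity of `X`. A parallel metric has constant
coefficients in the coordinates `X, Y`, and a linear change of coordinates brings it to `±dX² ± dY²`
(Sylvester); conversely `dX² + dY²` is parallel.

The constraints on the coefficients of the fourth order equation are the result of differentiating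
the root equation twice and comparing powers of `y_x`.
-/

noncomputable section

namespace CondLin

open Metric Filter Topology NNReal Asymptotics VectorField

/-- `F`, a function of two real variables with values in a normed space, is Fréchet differentiable
at `z` with partial derivatives `u` and `v`. -/
def HasPartialsAt {E : Type*} [NormedAddCommGroup E] [NormedSpace ℝ E] (F : ℝ × ℝ → E) (u v : E)
    (z : ℝ × ℝ) : Prop :=
  HasFDerivAt F ((ContinuousLinearMap.fst ℝ ℝ ℝ).smulRight u
    + (ContinuousLinearMap.snd ℝ ℝ ℝ).smulRight v) z

section CommutingFlows

variable {A : Type*} [NormedAddCommGroup A] [NormedSpace ℝ A] {X Y : A → A} {B : Set A} {K : ℝ≥0}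

theorem norm_sub_sub_fderiv_le {A' : Type*} [NormedAddCommGroup A'] [NormedSpace ℝ A'] {f : A → A'}
    (hB : Convex ℝ B) (hf : ∀ w ∈ B, DifferentiableAt ℝ f w)
    (hf' : LipschitzOnWith K (fderiv ℝ f) B) {v w : A} (hv : v ∈ B) (hw : w ∈ B) :
    ‖f w - f v - fderiv ℝ f v (w - v)‖ ≤ K * ‖w - v‖ ^ 2 := by
  have hseg : segment ℝ v w ⊆ B := hB.segment_subset hv hw
  have hbound : ∀ u ∈ segment ℝ v w, ‖fderiv ℝ f u - fderiv ℝ f v‖ ≤ K * ‖w - v‖ := by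
    intro u hu
    refine (hf'.norm_sub_le (hseg hu) hv).trans ?_
    gcongr
    exact norm_sub_le_of_mem_segment hu
  calc _ ≤ K * ‖w - v‖ * ‖w - v‖ :=
        (convex_segment v w).norm_image_sub_le_of_norm_hasFDerivWithin_le'
          (fun u hu ↦ (hf u (hseg hu)).hasFDerivAt.hasFDerivWithinAt) hbound
          (left_mem_segment ℝ v w) (right_mem_segment ℝ v w)
    _ = K * ‖w - v‖ ^ 2 := by ring

theorem norm_sub_le_mul_exp_of_integralCurves (hY : LipschitzOnWith K Y B) {β γ : ℝ → A}
    (hβ : ∀ t ∈ Icc (0 : ℝ) 1, β t ∈ B ∧ HasDerivAt β (Y (β t)) t)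
    (hγ : ∀ t ∈ Icc (0 : ℝ) 1, γ t ∈ B ∧ HasDerivAt γ (Y (γ t)) t) {t : ℝ}
    (ht : t ∈ Icc (0 : ℝ) 1) : ‖β t - γ t‖ ≤ ‖β 0 - γ 0‖ * Real.exp K := by
  have h := dist_le_of_trajectories_ODE_of_mem (v := fun _ ↦ Y) (s := fun _ ↦ B) (fun _ _ ↦ hY)
    (fun s hs ↦ (hβ s hs).2.continuousAt.continuousWithinAt)
    (fun s hs ↦ (hβ s (Ico_subset_Icc_self hs)).2.hasDerivWithinAt)
    (fun s hs ↦ (hβ s (Ico_subset_Icc_self hs)).1)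
    (fun s hs ↦ (hγ s hs).2.continuousAt.continuousWithinAt)
    (fun s hs ↦ (hγ s (Ico_subset_Icc_self hs)).2.hasDerivWithinAt)
    (fun s hs ↦ (hγ s (Ico_subset_Icc_self hs)).1) le_rfl t ht
  simp only [dist_eq_norm, sub_zero] at h
  refine h.trans ?_
  gcongr
  exact mul_le_of_le_one_right K.2 ht.2

theorem norm_sub_sub_le_gronwallBound_of_variational (hBo : IsOpen B) (hB : Convex ℝ B)
    (hYd : ∀ w ∈ B, DifferentiableAt ℝ Y w) (hY : LipschitzOnWith K Y B)
    (hY' : LipschitzOnWith K (fderiv ℝ Y) B) {β γ ξ : ℝ → A}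
    (hβ : ∀ t ∈ Icc (0 : ℝ) 1, β t ∈ B ∧ HasDerivAt β (Y (β t)) t)
    (hγ : ∀ t ∈ Icc (0 : ℝ) 1, γ t ∈ B ∧ HasDerivAt γ (Y (γ t)) t)
    (hξ : ∀ t ∈ Icc (0 : ℝ) 1, HasDerivAt ξ (fderiv ℝ Y (γ t) (ξ t)) t) :
    ‖β 1 - γ 1 - ξ 1‖ ≤
      gronwallBound ‖β 0 - γ 0 - ξ 0‖ K (K * (‖β 0 - γ 0‖ * Real.exp K) ^ 2) 1 := by
  have hder : ∀ t ∈ Icc (0 : ℝ) 1, HasDerivAt (fun t ↦ β t - γ t - ξ t)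
      (Y (β t) - Y (γ t) - fderiv ℝ Y (γ t) (ξ t)) t := fun t ht ↦
    ((hβ t ht).2.sub (hγ t ht).2).sub (hξ t ht)
  have hbound : ∀ t ∈ Icc (0 : ℝ) 1, ‖Y (β t) - Y (γ t) - fderiv ℝ Y (γ t) (ξ t)‖ ≤
      K * ‖β t - γ t - ξ t‖ + K * (‖β 0 - γ 0‖ * Real.exp K) ^ 2 := by
    intro t ht
    obtain ⟨hβt, -⟩ := hβ t ht
    obtain ⟨hγt, -⟩ := hγ t ht
    calc ‖Y (β t) - Y (γ t) - fderiv ℝ Y (γ t) (ξ t)‖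
        = ‖fderiv ℝ Y (γ t) (β t - γ t - ξ t)
          + (Y (β t) - Y (γ t) - fderiv ℝ Y (γ t) (β t - γ t))‖ := by
          rw [map_sub _ (β t - γ t)]; congr 1; abel
      _ ≤ K * ‖β t - γ t - ξ t‖ + K * ‖β t - γ t‖ ^ 2 :=
          norm_add_le_of_le (ContinuousLinearMap.le_of_opNorm_le _
            (norm_fderiv_le_of_lipschitzOn ℝ (hBo.mem_nhds hγt) hY) _)
            (norm_sub_sub_fderiv_le hB hYd hY' hγt hβt)
      _ ≤ _ := by gcongr; exact norm_sub_le_mul_exp_of_integralCurves hY hβ hγ ht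
  simpa only [sub_zero] using norm_le_gronwallBound_of_norm_deriv_right_le
    (fun t ht ↦ (hder t ht).continuousAt.continuousWithinAt)
    (fun t ht ↦ (hder t (Ico_subset_Icc_self ht)).hasDerivWithinAt) le_rfl
    (fun t ht ↦ hbound t (Ico_subset_Icc_self ht)) 1 (right_mem_Icc.2 zero_le_one)

theorem hasDerivAt_family_of_variational (hBo : IsOpen B) (hB : Convex ℝ B)
    (hYd : ∀ w ∈ B, DifferentiableAt ℝ Y w) (hK : 0 < K) (hY : LipschitzOnWith K Y B)
    (hY' : LipschitzOnWith K (fderiv ℝ Y) B) {γ : ℝ → ℝ → A} {ξ : ℝ → A} {s : ℝ}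
    (hγ : ∀ᶠ s' in 𝓝 s, ∀ t ∈ Icc (0 : ℝ) 1, γ s' t ∈ B ∧ HasDerivAt (γ s') (Y (γ s' t)) t)
    (hξ : ∀ t ∈ Icc (0 : ℝ) 1, HasDerivAt ξ (fderiv ℝ Y (γ s t) (ξ t)) t)
    (h₀ : HasDerivAt (γ · 0) (ξ 0) s) : HasDerivAt (γ · 1) (ξ 1) s := by
  have hK' : (K : ℝ) ≠ 0 := by exact_mod_cast hK.ne'
  have hγs := hγ.self_of_nhds
  have hbound : ∀ᶠ s' in 𝓝 s, ‖γ s' 1 - γ s 1 - (s' - s) • ξ 1‖ ≤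
      Real.exp K ^ 3 * ‖‖γ s' 0 - γ s 0 - (s' - s) • ξ 0‖ + ‖γ s' 0 - γ s 0‖ ^ 2‖ := by
    filter_upwards [hγ] with s' hs'
    have h := norm_sub_sub_le_gronwallBound_of_variational (ξ := fun t ↦ (s' - s) • ξ t)
      hBo hB hYd hY hY' hs' hγs fun t ht ↦ by
        simpa only [map_smul] using (hξ t ht).fun_const_smul (s' - s)
    refine h.trans ?_
    simp only [gronwallBound_of_K_ne_0 hK', mul_div_cancel_left₀ _ hK', mul_one]
    rw [Real.norm_of_nonneg (by positivity)]
    have h1 : 1 ≤ Real.exp K := Real.one_le_exp K.2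
    calc _ ≤ ‖γ s' 0 - γ s 0 - (s' - s) • ξ 0‖ * Real.exp K ^ 3
          + (‖γ s' 0 - γ s 0‖ * Real.exp K) ^ 2 * Real.exp K := by
          gcongr
          · exact le_self_pow₀ h1 three_ne_zero
          · linarith
      _ = _ := by ring
  refine .of_isLittleO ((IsBigO.of_bound _ hbound).trans_isLittleO (.add ?_ ?_))
  · exact h₀.isLittleO.norm_left
  · exact (h₀.isBigO_sub.norm_norm.pow 2).trans_isLittleO (isLittleO_pow_sub_sub s one_lt_two)

theorem hasDerivAt_fst_of_lieBracket_eq_zero (hBo : IsOpen B) (hB : Convex ℝ B)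
    (hX : ∀ w ∈ B, DifferentiableAt ℝ X w) (hYd : ∀ w ∈ B, DifferentiableAt ℝ Y w)
    (hY : LipschitzOnWith K Y B) (hY' : LipschitzOnWith K (fderiv ℝ Y) B)
    (hXY : ∀ w ∈ B, lieBracket ℝ X Y w = 0) {w : ℝ × ℝ → A} {δ : ℝ}
    (hw : ∀ z ∈ ball (0 : ℝ × ℝ) δ, w z ∈ B ∧ HasDerivAt (fun t ↦ w (z.1, t)) (Y (w z)) z.2)
    (hw₀ : ∀ s ∈ ball (0 : ℝ) δ, HasDerivAt (fun s ↦ w (s, 0)) (X (w (s, 0))) s)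
    {z : ℝ × ℝ} (hz : z ∈ ball 0 δ) : HasDerivAt (fun s ↦ w (s, z.2)) (X (w z)) z.1 := by
  obtain ⟨s, t⟩ := z
  obtain ⟨hs, ht⟩ : s ∈ ball 0 δ ∧ t ∈ ball 0 δ := by simpa [← ball_prod_same] using hz
  have hmem : ∀ s' ∈ ball (0 : ℝ) δ, ∀ θ ∈ Icc (0 : ℝ) 1, (s', θ * t) ∈ ball (0 : ℝ × ℝ) δ := by
    intro s' hs' θ hθ
    rw [← Prod.mk_zero_zero, ← ball_prod_same]
    exact ⟨hs', (convex_ball 0 δ).starConvex (mem_ball_self (pos_of_mem_ball ht)) |>.smul_mem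
      ht hθ.1 hθ.2⟩
  have hγ : ∀ s' ∈ ball (0 : ℝ) δ, ∀ θ ∈ Icc (0 : ℝ) 1, w (s', θ * t) ∈ B ∧
      HasDerivAt (fun θ ↦ w (s', θ * t)) (t • Y (w (s', θ * t))) θ := by
    intro s' hs' θ hθ
    obtain ⟨hwB, hd⟩ := hw _ (hmem s' hs' θ hθ)
    exact ⟨hwB, HasDerivAt.scomp (h := fun θ ↦ θ * t) θ hd (hasDerivAt_mul_const t)⟩
  have hfderiv : ∀ v ∈ B, fderiv ℝ (fun v ↦ t • Y v) v = t • fderiv ℝ Y v := fun v hv ↦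
    fderiv_fun_const_smul (hYd v hv) t
  have hξ : ∀ θ ∈ Icc (0 : ℝ) 1, HasDerivAt (fun θ ↦ X (w (s, θ * t)))
      (fderiv ℝ (fun v ↦ t • Y v) (w (s, θ * t)) (X (w (s, θ * t)))) θ := by
    intro θ hθ
    obtain ⟨hwB, hd⟩ := hγ s hs θ hθ
    have hcomm : fderiv ℝ Y (w (s, θ * t)) (X (w (s, θ * t)))
        = fderiv ℝ X (w (s, θ * t)) (Y (w (s, θ * t))) := sub_eq_zero.1 (hXY _ hwB)
    have h := (hX _ hwB).hasFDerivAt.comp_hasDerivAt θ hd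
    rw [hfderiv _ hwB, smul_apply, hcomm]
    rwa [map_smul] at h
  have hlip : ∀ {E : Type _} [NormedAddCommGroup E] [NormedSpace ℝ E] {f : A → E},
      LipschitzOnWith K f B → LipschitzOnWith (‖t‖₊ * K + 1) (fun v ↦ t • f v) B := fun hf ↦
    ((lipschitzWith_smul t).comp_lipschitzOnWith hf).weaken le_self_add
  have := hasDerivAt_family_of_variational (Y := fun v ↦ t • Y v) (s := s)
    (γ := fun s' θ ↦ w (s', θ * t)) hBo hB (fun v hv ↦ (hYd v hv).fun_const_smul t)
    (by positivity) (hlip hY)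
    (fun v hv v' hv' ↦ by rw [hfderiv v hv, hfderiv v' hv']; exact hlip hY' hv hv')
    (eventually_of_mem (isOpen_ball.mem_nhds hs) hγ) hξ (by simpa using hw₀ s hs)
  simpa using this

theorem exists_isOpen_convex_lipschitzOnWith {w₀ : A} (hY : ContDiffAt ℝ 2 Y w₀) {p : A → Prop}
    (hp : ∀ᶠ w in 𝓝 w₀, p w) :
    ∃ B : Set A, IsOpen B ∧ w₀ ∈ B ∧ Convex ℝ B ∧ (∀ w ∈ B, p w ∧ DifferentiableAt ℝ Y w) ∧
      ∃ K, LipschitzOnWith K Y B ∧ LipschitzOnWith K (fderiv ℝ Y) B := by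
  obtain ⟨K₁, s₁, hs₁, hY₁⟩ := (hY.of_le one_le_two).exists_lipschitzOnWith
  obtain ⟨K₂, s₂, hs₂, hY₂⟩ :=
    (hY.fderiv_right (m := 1) (by norm_num)).exists_lipschitzOnWith
  have hd : ∀ᶠ w in 𝓝 w₀, DifferentiableAt ℝ Y w :=
    (hY.eventually (by simp)).mono fun w hw ↦ hw.differentiableAt two_ne_zero
  obtain ⟨ρ, hρ, hball⟩ := Metric.mem_nhds_iff.1
    (inter_mem (inter_mem hs₁ hs₂) (hp.and hd))
  refine ⟨ball w₀ ρ, isOpen_ball, mem_ball_self hρ, convex_ball _ _, fun w hw ↦ (hball hw).2,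
    max K₁ K₂, ?_, ?_⟩
  · exact (hY₁.mono fun w hw ↦ (hball hw).1.1).weaken (le_max_left _ _)
  · exact (hY₂.mono fun w hw ↦ (hball hw).1.2).weaken (le_max_right _ _)

theorem exists_continuousAt_flow [CompleteSpace A] {w₀ : A} (hY : ContDiffAt ℝ 1 Y w₀) :
    ∃ φ : A × ℝ → A, ∀ᶠ p in 𝓝 (w₀, (0 : ℝ)),
      φ (p.1, 0) = p.1 ∧ HasDerivAt (fun t ↦ φ (p.1, t)) (Y (φ p)) p.2 ∧ ContinuousAt φ p := by
  obtain ⟨ε, hε, a, r, L, K, hr, h⟩ := IsPicardLindelof.of_contDiffAt_one hY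
  obtain ⟨φ, hφ, hcont⟩ := (h 0).exists_forall_mem_closedBall_eq_hasDerivWithinAt_continuousOn
  refine ⟨φ, ?_⟩
  have hmem : ball w₀ r ×ˢ Ioo (0 - ε) (0 + ε) ∈ 𝓝 (w₀, (0 : ℝ)) :=
    prod_mem_nhds (ball_mem_nhds w₀ hr) (Ioo_mem_nhds (by linarith) (by linarith))
  filter_upwards [hmem] with p ⟨hp₁, hp₂⟩
  obtain ⟨hφ₀, hφt⟩ := hφ p.1 (ball_subset_closedBall hp₁)
  have hIcc : Icc (0 - ε) (0 + ε) ∈ 𝓝 p.2 := Icc_mem_nhds hp₂.1 hp₂.2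
  exact ⟨hφ₀, (hφt p.2 (Ioo_subset_Icc_self hp₂)).hasDerivAt hIcc,
    hcont.continuousAt (prod_mem_nhds (mem_of_superset (isOpen_ball.mem_nhds hp₁)
      ball_subset_closedBall) hIcc)⟩

theorem exists_composite_flow [CompleteSpace A] {w₀ : A} (hX : ContDiffAt ℝ 1 X w₀)
    (hY : ContDiffAt ℝ 1 Y w₀) (hB : B ∈ 𝓝 w₀) :
    ∃ w : ℝ × ℝ → A, w 0 = w₀ ∧ ∀ᶠ z in 𝓝 0, w z ∈ B ∧ ContinuousAt w z ∧
      HasDerivAt (fun s ↦ w (s, 0)) (X (w (z.1, 0))) z.1 ∧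
      HasDerivAt (fun t ↦ w (z.1, t)) (Y (w z)) z.2 := by
  obtain ⟨α, hα₀, ε, hε, hα⟩ :=
    hX.exists_forall_mem_closedBall_exists_eq_forall_mem_Ioo_hasDerivAt₀ 0
  obtain ⟨φ, hφ⟩ := exists_continuousAt_flow hY
  have hα' : ∀ᶠ s in 𝓝 (0 : ℝ), HasDerivAt α (X (α s)) s :=
    eventually_of_mem (Ioo_mem_nhds (by linarith) (by linarith)) hα
  have hφ₀ := hφ.self_of_nhds
  have hφB : ∀ᶠ q in 𝓝 (w₀, (0 : ℝ)), φ q ∈ B :=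
    hφ₀.2.2.eventually_mem (by simpa only [hφ₀.1] using hB)
  have hcont : ∀ s t, HasDerivAt α (X (α s)) s →
      ContinuousAt (fun z : ℝ × ℝ ↦ (α z.1, z.2)) (s, t) := fun s t hs ↦
    (hs.continuousAt.comp' continuousAt_fst).prodMk continuousAt_snd
  have htend : Tendsto (fun z : ℝ × ℝ ↦ (α z.1, z.2)) (𝓝 0) (𝓝 (w₀, 0)) := by
    have h := (hcont 0 0 hα'.self_of_nhds).tendsto
    rwa [hα₀] at h
  have hsection : ∀ᶠ s in 𝓝 (0 : ℝ), φ (α s, 0) = α s :=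
    ((Continuous.prodMk_left (0 : ℝ)).tendsto' 0 0 rfl).eventually (htend.eventually hφ) |>.mono
      fun s hs ↦ hs.1
  refine ⟨fun z ↦ φ (α z.1, z.2), (congrArg (fun a ↦ φ (a, 0)) hα₀).trans hφ₀.1, ?_⟩
  filter_upwards [htend.eventually (hφ.and hφB), continuousAt_fst.eventually hα',
    continuousAt_fst.eventually hsection.eventually_nhds] with z hz hαz hsz
  refine ⟨hz.2, ContinuousAt.comp' (f := fun z : ℝ × ℝ ↦ (α z.1, z.2)) hz.1.2.2
    (hcont z.1 z.2 hαz), ?_, hz.1.2.1⟩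
  rw [hz.1.1]
  exact hαz.congr_of_eventuallyEq hsz

theorem hasPartialsAt_of_continuousAt {w f g : ℝ × ℝ → A} {z : ℝ × ℝ}
    (hf : ∀ᶠ v in 𝓝 z, HasDerivAt (fun s ↦ w (s, v.2)) (f v) v.1)
    (hg : ∀ᶠ v in 𝓝 z, HasDerivAt (fun t ↦ w (v.1, t)) (g v) v.2)
    (hfc : ContinuousAt f z) (hgc : ContinuousAt g z) : HasPartialsAt w (f z) (g z) z := by
  have hspan := (ContinuousLinearMap.toSpanSingletonCLE (𝕜 := ℝ) (E := A)).continuous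
  have h := hasStrictFDerivAt_uncurry_coprod (𝕜 := ℝ) (f := fun s t ↦ w (s, t))
    (f₁ := fun s t ↦ .toSpanSingleton ℝ (f (s, t))) (f₂ := fun s t ↦ .toSpanSingleton ℝ (g (s, t)))
    (hf.mono fun v hv ↦ hv.hasFDerivAt) (hg.mono fun v hv ↦ hv.hasFDerivAt)
    (hspan.continuousAt.comp' hfc) (hspan.continuousAt.comp' hgc)
  exact h.hasFDerivAt.congr_fderiv (by ext <;> simp [Function.HasUncurry.uncurry])

theorem exists_hasPartialsAt_of_lieBracket_eq_zero [CompleteSpace A] {w₀ : A}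
    (hX : ContDiffAt ℝ 1 X w₀) (hY : ContDiffAt ℝ 2 Y w₀)
    (hXY : ∀ᶠ w in 𝓝 w₀, lieBracket ℝ X Y w = 0) :
    ∃ w : ℝ × ℝ → A, w 0 = w₀ ∧ ∀ᶠ z in 𝓝 0, HasPartialsAt w (X (w z)) (Y (w z)) z := by
  have hXd : ∀ᶠ w in 𝓝 w₀, DifferentiableAt ℝ X w :=
    (hX.eventually (by simp)).mono fun w hw ↦ hw.differentiableAt one_ne_zero
  obtain ⟨B, hBo, hw₀B, hB, hBXY, K, hYB, hYB'⟩ :=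
    exists_isOpen_convex_lipschitzOnWith hY (hXd.and hXY)
  obtain ⟨w, hw₀, hw⟩ := exists_composite_flow hX (hY.of_le one_le_two) (hBo.mem_nhds hw₀B)
  obtain ⟨δ, hδ, hball⟩ := Metric.eventually_nhds_iff_ball.1 hw
  refine ⟨w, hw₀, eventually_of_mem (ball_mem_nhds 0 hδ) fun z hz ↦ ?_⟩
  obtain ⟨⟨⟨hXz, -⟩, hYz⟩, hwz⟩ := And.intro (hBXY _ (hball z hz).1) (hball z hz).2.1
  have hx₀ : ∀ s ∈ ball (0 : ℝ) δ, HasDerivAt (fun s ↦ w (s, 0)) (X (w (s, 0))) s := by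
    intro s hs
    refine (hball (s, 0) ?_).2.2.1
    rw [← Prod.mk_zero_zero, ← ball_prod_same]
    exact ⟨hs, mem_ball_self hδ⟩
  refine hasPartialsAt_of_continuousAt (f := fun z ↦ X (w z)) (g := fun z ↦ Y (w z))
    (eventually_of_mem (isOpen_ball.mem_nhds hz) fun v hv ↦ ?_)
    (eventually_of_mem (isOpen_ball.mem_nhds hz) fun v hv ↦ (hball v hv).2.2.2)
    (hXz.continuousAt.comp' hwz) (hYz.continuousAt.comp' hwz)
  exact hasDerivAt_fst_of_lieBracket_eq_zero hBo hB (fun u hu ↦ (hBXY u hu).1.1)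
    (fun u hu ↦ (hBXY u hu).2) hYB hYB' (fun u hu ↦ (hBXY u hu).1.2)
    (fun u hu ↦ ⟨(hball u hu).1, (hball u hu).2.2.2⟩) hx₀ hv

end CommutingFlows

section TotalDifferential

variable {E : Type*} [NormedAddCommGroup E] [NormedSpace ℝ E] {O : Set ((ℝ × ℝ) × E)}
  {F G : (ℝ × ℝ) × E → E}

theorem contDiffOn_of_total_differential (hF : ContDiffOn ℝ ∞ F O) (hG : ContDiffOn ℝ ∞ G O)
    {V : Set (ℝ × ℝ)} (hV : IsOpen V) {v : ℝ × ℝ → E} (hmem : ∀ z ∈ V, (z, v z) ∈ O)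
    (hv : ∀ z ∈ V, HasPartialsAt v (F (z, v z)) (G (z, v z)) z) : ContDiffOn ℝ ∞ v V := by
  rw [contDiffOn_infty]
  intro n
  induction n with
  | zero => exact contDiffOn_zero.2 fun z hz ↦ (hv z hz).continuousAt.continuousWithinAt
  | succ n ih =>
    have hw : ContDiffOn ℝ n (fun z ↦ (z, v z)) V := contDiffOn_id.prodMk ih
    have hFn : ContDiffOn ℝ n (fun z ↦ F (z, v z)) V :=
      (hF.of_le (by exact_mod_cast le_top)).comp hw hmem
    have hGn : ContDiffOn ℝ n (fun z ↦ G (z, v z)) V :=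
      (hG.of_le (by exact_mod_cast le_top)).comp hw hmem
    rw [Nat.cast_add, Nat.cast_one, contDiffOn_succ_iff_fderiv_of_isOpen hV]
    refine ⟨fun z hz ↦ (hv z hz).differentiableAt.differentiableWithinAt, by simp, ?_⟩
    refine ContDiffOn.congr ?_ fun z hz ↦ (hv z hz).fderiv
    exact (contDiffOn_const.smulRight hFn).add (contDiffOn_const.smulRight hGn)

theorem eq_add_of_hasPartialsAt {f : ℝ × ℝ → ℝ × ℝ} {δ : ℝ}
    (hf : ∀ z ∈ ball 0 δ, HasPartialsAt f (1, 0) (0, 1) z) {z : ℝ × ℝ} (hz : z ∈ ball 0 δ) :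
    f z = f 0 + z := by
  have hd : ∀ z ∈ ball (0 : ℝ × ℝ) δ, HasFDerivAt (fun z ↦ f z - z) 0 z := fun z hz ↦
    ((hf z hz).sub (hasFDerivAt_id z)).congr_fderiv (by ext <;> simp)
  have hconst := isOpen_ball.is_const_of_fderiv_eq_zero (𝕜 := ℝ)
    (convex_ball (0 : ℝ × ℝ) δ).isPreconnected
    (fun z hz ↦ (hd z hz).differentiableAt.differentiableWithinAt)
    (fun z hz ↦ (hd z hz).fderiv) hz (mem_ball_self (pos_of_mem_ball hz))
  simpa only [sub_zero, sub_eq_iff_eq_add] using hconst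

-- The compatibility condition says that the lifted fields `((1, 0), F)` and `((0, 1), G)` commute.
theorem exists_local_solution_total_differential [CompleteSpace E] (hO : IsOpen O)
    (hF : ContDiffOn ℝ ∞ F O) (hG : ContDiffOn ℝ ∞ G O)
    (hcomp : ∀ w ∈ O, fderiv ℝ F w ((0, 1), G w) = fderiv ℝ G w ((1, 0), F w))
    {z₀ : ℝ × ℝ} {v₀ : E} (h₀ : (z₀, v₀) ∈ O) :
    ∃ v : ℝ × ℝ → E, v z₀ = v₀ ∧
      ∀ᶠ z in 𝓝 z₀, (z, v z) ∈ O ∧ HasPartialsAt v (F (z, v z)) (G (z, v z)) z := by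
  let X : (ℝ × ℝ) × E → (ℝ × ℝ) × E := fun w ↦ ((1, 0), F w)
  let Y : (ℝ × ℝ) × E → (ℝ × ℝ) × E := fun w ↦ ((0, 1), G w)
  have hlift : ∀ {H : (ℝ × ℝ) × E → E} {e : ℝ × ℝ}, ContDiffOn ℝ ∞ H O → ∀ w ∈ O,
      HasFDerivAt (fun w ↦ (e, H w)) ((0 : (ℝ × ℝ) × E →L[ℝ] ℝ × ℝ).prod (fderiv ℝ H w)) w :=
    fun hH w hw ↦ (hasFDerivAt_const _ w).prodMk
      ((hH.contDiffAt (hO.mem_nhds hw)).differentiableAt (by simp)).hasFDerivAt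
  have hXY : ∀ w ∈ O, lieBracket ℝ X Y w = 0 := fun w hw ↦ by
    rw [lieBracket, (hlift hF w hw).fderiv, (hlift hG w hw).fderiv]
    simp [X, Y, hcomp w hw]
  have hsmooth : ∀ {H : (ℝ × ℝ) × E → E} {n : ℕ∞} (e : ℝ × ℝ), ContDiffOn ℝ ∞ H O →
      ContDiffAt ℝ n (fun w ↦ (e, H w)) (z₀, v₀) := fun e hH ↦
    contDiffAt_const.prodMk
      ((hH.contDiffAt (hO.mem_nhds h₀)).of_le (by exact_mod_cast le_top))
  obtain ⟨w, hw₀, hw⟩ := exists_hasPartialsAt_of_lieBracket_eq_zero (X := X) (Y := Y)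
    (hsmooth (1, 0) hF) (hsmooth (0, 1) hG) (eventually_of_mem (hO.mem_nhds h₀) hXY)
  have hO' : ∀ᶠ ζ in 𝓝 0, w ζ ∈ O :=
    hw.self_of_nhds.continuousAt.eventually_mem (hO.mem_nhds (by rwa [hw₀]))
  obtain ⟨δ, hδ, hball⟩ := Metric.eventually_nhds_iff_ball.1 (hw.and hO')
  have hbase : ∀ ζ ∈ ball (0 : ℝ × ℝ) δ, (w ζ).1 = z₀ + ζ := fun ζ hζ ↦ by
    have h := eq_add_of_hasPartialsAt (f := fun ζ ↦ (w ζ).1)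
      (fun ζ hζ ↦ (hball ζ hζ).1.fst.congr_fderiv (by ext <;> simp [X, Y])) hζ
    rwa [hw₀] at h
  refine ⟨fun z ↦ (w (z - z₀)).2, by simp [hw₀], ?_⟩
  have hsub : Tendsto (fun z ↦ z - z₀) (𝓝 z₀) (𝓝 0) := by
    simpa using (continuous_sub_right z₀).tendsto z₀
  filter_upwards [hsub.eventually_mem (ball_mem_nhds 0 hδ)] with z hz
  have hz' : w (z - z₀) = (z, (w (z - z₀)).2) :=
    Prod.ext (by rw [hbase _ hz, add_sub_cancel]) rfl
  rw [← hz']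
  have hv : HasPartialsAt (fun ζ ↦ (w ζ).2) (F (w (z - z₀))) (G (w (z - z₀))) (z - z₀) :=
    (hball _ hz).1.snd.congr_fderiv (by ext <;> simp [X, Y])
  have hv' := HasFDerivAt.comp (g := fun ζ ↦ (w ζ).2) (f := (· - z₀)) z hv
    (hasFDerivAt_sub_const z₀)
  exact ⟨(hball _ hz).2, hv'.congr_fderiv (ContinuousLinearMap.comp_id _)⟩

theorem exists_solution_total_differential [CompleteSpace E] (hO : IsOpen O)
    (hF : ContDiffOn ℝ ∞ F O) (hG : ContDiffOn ℝ ∞ G O)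
    (hcomp : ∀ w ∈ O, fderiv ℝ F w ((0, 1), G w) = fderiv ℝ G w ((1, 0), F w))
    {z₀ : ℝ × ℝ} {v₀ : E} (h₀ : (z₀, v₀) ∈ O) :
    ∃ V : Set (ℝ × ℝ), IsOpen V ∧ z₀ ∈ V ∧ ∃ v : ℝ × ℝ → E, v z₀ = v₀ ∧ ContDiffOn ℝ ∞ v V ∧
      ∀ z ∈ V, (z, v z) ∈ O ∧ HasPartialsAt v (F (z, v z)) (G (z, v z)) z := by
  obtain ⟨v, hv₀, hv⟩ := exists_local_solution_total_differential hO hF hG hcomp h₀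
  obtain ⟨V, hVv, hV, hz₀V⟩ := _root_.eventually_nhds_iff.1 hv
  exact ⟨V, hV, hz₀V, v, hv₀, contDiffOn_of_total_differential hF hG hV
    (fun z hz ↦ (hVv z hz).1) fun z hz ↦ (hVv z hz).2, hVv⟩

end TotalDifferential

section Partial

variable {F H : ℝ × ℝ → ℝ} {U V : Set (ℝ × ℝ)} {z : ℝ × ℝ} {u v u' v' : ℝ}

namespace HasPartialsAt

theorem px_eq (h : HasPartialsAt F u v z) : px F z = u :=
  ((HasFDerivAt.comp_hasDerivAt (f := (·, z.2)) z.1 h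
    ((hasDerivAt_id z.1).prodMk (hasDerivAt_const z.1 z.2))).congr_deriv (by simp)).deriv

theorem py_eq (h : HasPartialsAt F u v z) : py F z = v :=
  ((HasFDerivAt.comp_hasDerivAt (f := (z.1, ·)) z.2 h
    ((hasDerivAt_const z.2 z.1).prodMk (hasDerivAt_id z.2))).congr_deriv (by simp)).deriv

theorem congr_of_eqOn (h : HasPartialsAt F u v z) (hU : IsOpen U) (hFH : EqOn H F U) (hz : z ∈ U) :
    HasPartialsAt H u v z :=
  HasFDerivAt.congr_of_eventuallyEq h (hFH.eventuallyEq_of_mem (hU.mem_nhds hz))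

theorem congr_partials (h : HasPartialsAt F u v z) (hu : u = u') (hv : v = v') :
    HasPartialsAt F u' v' z :=
  hu ▸ hv ▸ h

theorem add (hF : HasPartialsAt F u v z) (hH : HasPartialsAt H u' v' z) :
    HasPartialsAt (fun w ↦ F w + H w) (u + u') (v + v') z :=
  (HasFDerivAt.add hF hH).congr_fderiv (by ext <;> simp)

theorem sub (hF : HasPartialsAt F u v z) (hH : HasPartialsAt H u' v' z) :
    HasPartialsAt (fun w ↦ F w - H w) (u - u') (v - v') z :=
  (HasFDerivAt.sub hF hH).congr_fderiv (by ext <;> simp)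

theorem mul (hF : HasPartialsAt F u v z) (hH : HasPartialsAt H u' v' z) :
    HasPartialsAt (fun w ↦ F w * H w) (u * H z + F z * u') (v * H z + F z * v') z :=
  (HasFDerivAt.mul hF hH).congr_fderiv (by ext <;> simp <;> ring)

theorem const_mul (k : ℝ) (hF : HasPartialsAt F u v z) :
    HasPartialsAt (fun w ↦ k * F w) (k * u) (k * v) z :=
  (HasFDerivAt.const_mul hF k).congr_fderiv (by ext <;> simp)

theorem hasDerivAt_graph {y : ℝ → ℝ} {y' x : ℝ} (h : HasPartialsAt F u v (x, y x))
    (hy : HasDerivAt y y' x) : HasDerivAt (fun s ↦ F (s, y s)) (u + v * y') x :=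
  (HasFDerivAt.comp_hasDerivAt (f := fun s ↦ (s, y s)) x h
    ((hasDerivAt_id x).prodMk hy)).congr_deriv (by simp [mul_comm])

end HasPartialsAt

namespace Smooth

theorem mono (hF : Smooth F U) (h : V ⊆ U) : Smooth F V :=
  ContDiffOn.mono hF h

theorem const_mul (k : ℝ) (hF : Smooth F U) : Smooth (fun w ↦ k * F w) U :=
  contDiffOn_const.mul hF

theorem contDiffAt (hF : Smooth F U) (hU : IsOpen U) (hz : z ∈ U) : ContDiffAt ℝ ∞ F z :=
  ContDiffOn.contDiffAt hF (hU.mem_nhds hz)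

theorem hasFDerivAt (hF : Smooth F U) (hU : IsOpen U) (hz : z ∈ U) :
    HasFDerivAt F (fderiv ℝ F z) z :=
  ((hF.contDiffAt hU hz).differentiableAt (by simp)).hasFDerivAt

theorem hasPartialsAt_fderiv (hF : Smooth F U) (hU : IsOpen U) (hz : z ∈ U) :
    HasPartialsAt F (fderiv ℝ F z (1, 0)) (fderiv ℝ F z (0, 1)) z :=
  (hF.hasFDerivAt hU hz).congr_fderiv (by ext <;> simp)

theorem hasPartialsAt (hF : Smooth F U) (hU : IsOpen U) (hz : z ∈ U) :
    HasPartialsAt F (px F z) (py F z) z :=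
  have h := hF.hasPartialsAt_fderiv hU hz
  h.congr_partials h.px_eq.symm h.py_eq.symm

protected theorem px (hF : Smooth F U) (hU : IsOpen U) : Smooth (px F) U :=
  ContDiffOn.congr (((contDiffOn_infty_iff_fderiv_of_isOpen hU).1 hF).2.clm_apply contDiffOn_const)
    fun _ hz ↦ (hF.hasPartialsAt_fderiv hU hz).px_eq

protected theorem py (hF : Smooth F U) (hU : IsOpen U) : Smooth (py F) U :=
  ContDiffOn.congr (((contDiffOn_infty_iff_fderiv_of_isOpen hU).1 hF).2.clm_apply contDiffOn_const)
    fun _ hz ↦ (hF.hasPartialsAt_fderiv hU hz).py_eq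

theorem px_py (hF : Smooth F U) (hU : IsOpen U) (hz : z ∈ U) : px (py F) z = py (px F) z := by
  have hd : DifferentiableAt ℝ (fderiv ℝ F) z :=
    ((hF.contDiffAt hU hz).fderiv_right (m := 1) (by norm_cast)).differentiableAt (by simp)
  have hsymm : IsSymmSndFDerivAt ℝ F z := by
    refine (hF.contDiffAt hU hz).isSymmSndFDerivAt ?_
    simpa using (mod_cast le_top : ((2 : ℕ∞) : ℕ∞ω) ≤ ∞)
  have h : ∀ e : ℝ × ℝ, HasPartialsAt (fun w ↦ fderiv ℝ F w e)
      (fderiv ℝ (fderiv ℝ F) z (1, 0) e) (fderiv ℝ (fderiv ℝ F) z (0, 1) e) z := fun e ↦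
    (hd.hasFDerivAt.clm_apply (hasFDerivAt_const e z)).congr_fderiv (by ext <;> simp)
  rw [((h (0, 1)).congr_of_eqOn hU (fun w hw ↦ (hF.hasPartialsAt_fderiv hU hw).py_eq) hz).px_eq,
    ((h (1, 0)).congr_of_eqOn hU (fun w hw ↦ (hF.hasPartialsAt_fderiv hU hw).px_eq) hz).py_eq]
  exact hsymm.eq _ _

end Smooth

end Partial

section Proportional

variable {E : Type*} [NormedAddCommGroup E] [NormedSpace ℝ E] {s : Set E} {F H : E → ℝ}
  {κ : E → E →L[ℝ] ℝ}

-- Solutions of the same linear equation are proportional: the quotient `F / H` is constant.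
theorem mul_eq_mul_of_hasFDerivAt_smul (hs : IsOpen s) (hs' : IsPreconnected s)
    (hF : ∀ z ∈ s, HasFDerivAt F (F z • κ z) z) (hH : ∀ z ∈ s, HasFDerivAt H (H z • κ z) z)
    (hH₀ : ∀ z ∈ s, H z ≠ 0) {z z₀ : E} (hz : z ∈ s) (hz₀ : z₀ ∈ s) :
    F z * H z₀ = F z₀ * H z := by
  have hd : ∀ z ∈ s, HasFDerivAt (fun z ↦ F z / H z) 0 z := fun z hz ↦ by
    have hinv := (hasDerivAt_inv (hH₀ z hz)).comp_hasFDerivAt z (hH z hz)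
    refine ((hF z hz).mul hinv).congr_fderiv ?_
    ext e
    have := hH₀ z hz
    simp only [neg_smul, smul_neg, Function.comp_apply, add_apply, neg_apply, smul_apply,
      smul_eq_mul, zero_apply]
    field_simp
    ring
  have hconst : F z / H z = F z₀ / H z₀ := hs.is_const_of_fderiv_eq_zero (𝕜 := ℝ) hs'
    (fun z hz ↦ (hd z hz).differentiableAt.differentiableWithinAt)
    (fun z hz ↦ (hd z hz).fderiv) hz hz₀
  exact (div_eq_div_iff (hH₀ z hz) (hH₀ z₀ hz₀)).1 hconst

end Proportional

section Graph

variable {F : ℝ × ℝ → ℝ} {U : Set (ℝ × ℝ)} {I : Set ℝ} {y : ℝ → ℝ} {x : ℝ} {n : ℕ}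

theorem hasDerivAt_iteratedDeriv_of_contDiffOn (hI : IsOpen I) (hy : ContDiffOn ℝ n y I) {k : ℕ}
    (hk : k < n) (hx : x ∈ I) : HasDerivAt (iteratedDeriv k y) (iteratedDeriv (k + 1) y x) x := by
  rw [iteratedDeriv_succ]
  have h := hy.differentiableOn_iteratedDerivWithin (m := k) (by exact_mod_cast hk) hI.uniqueDiffOn
  refine ((h.congr fun s hs ↦ ?_).differentiableAt (hI.mem_nhds hx)).hasDerivAt
  exact (iteratedDerivWithin_of_isOpen hI hs).symm

theorem hasDerivAt_of_contDiffOn (hI : IsOpen I) (hy : ContDiffOn ℝ n y I) (hn : 0 < n)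
    (hx : x ∈ I) : HasDerivAt y (deriv y x) x := by
  simpa only [iteratedDeriv_zero, zero_add, iteratedDeriv_one] using
    hasDerivAt_iteratedDeriv_of_contDiffOn hI hy hn hx

theorem hasDerivAt_deriv_of_contDiffOn (hI : IsOpen I) (hy : ContDiffOn ℝ n y I) (hn : 1 < n)
    (hx : x ∈ I) : HasDerivAt (deriv y) (iteratedDeriv 2 y x) x := by
  simpa only [iteratedDeriv_one, Nat.reduceAdd] using
    hasDerivAt_iteratedDeriv_of_contDiffOn hI hy hn hx

/-- The first derivative of `x ↦ F (x, y x)`, expressed through the partial derivatives of `F`. -/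
def graphDeriv (F : ℝ × ℝ → ℝ) (y : ℝ → ℝ) (x : ℝ) : ℝ :=
  px F (x, y x) + py F (x, y x) * deriv y x

/-- The second derivative of `x ↦ F (x, y x)`, expressed through the partial derivatives of `F`. -/
def graphDeriv₂ (F : ℝ × ℝ → ℝ) (y : ℝ → ℝ) (x : ℝ) : ℝ :=
  px (px F) (x, y x) + 2 * py (px F) (x, y x) * deriv y x
    + py (py F) (x, y x) * deriv y x ^ 2 + py F (x, y x) * iteratedDeriv 2 y x

theorem Smooth.hasDerivAt_graph (hF : Smooth F U) (hU : IsOpen U)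
    (hy : HasDerivAt y (deriv y x) x) (hx : (x, y x) ∈ U) :
    HasDerivAt (fun s ↦ F (s, y s)) (graphDeriv F y x) x :=
  (hF.hasPartialsAt hU hx).hasDerivAt_graph hy

theorem Smooth.hasDerivAt_graphDeriv (hF : Smooth F U) (hU : IsOpen U)
    (hy : HasDerivAt y (deriv y x) x) (hy' : HasDerivAt (deriv y) (iteratedDeriv 2 y x) x)
    (hx : (x, y x) ∈ U) : HasDerivAt (graphDeriv F y) (graphDeriv₂ F y x) x := by
  refine (((hF.px hU).hasDerivAt_graph hU hy hx).add
    (((hF.py hU).hasDerivAt_graph hU hy hx).mul hy')).congr_deriv ?_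
  simp only [graphDeriv, graphDeriv₂, hF.px_py hU hx]
  ring

end Graph

section TwiceDifferentiatedRoot

variable {R : Root} {Q : FourthOrder} {U : Set (ℝ × ℝ)} {I : Set ℝ} {y : ℝ → ℝ} {x : ℝ}

/-- Smoothness on `U` of the coefficients of a root equation. -/
structure Root.SmoothOn (R : Root) (U : Set (ℝ × ℝ)) : Prop where
  c : Smooth R.c U
  g : Smooth R.g U
  h : Smooth R.h U
  d : Smooth R.d U

theorem FourthOrder.SmoothOn.root (hU : IsOpen U) (hQ : Q.SmoothOn U)
    (hA : ∀ z ∈ U, Q.A2 z ≠ 0) : Q.root.SmoothOn U := by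
  obtain ⟨hA0, hA1, hA2, -, -, -, -, hB4, -, -, -⟩ := hQ
  have hc : Smooth Q.c U := ContDiffOn.div_const hA2 3
  refine ⟨hc, ContDiffOn.div_const hA1 2, hA0, ?_⟩
  have hcx : ContDiffOn ℝ ∞ (px Q.c) U := hc.px hU
  have hcy : ContDiffOn ℝ ∞ (py Q.c) U := hc.py hU
  have hcxy : ContDiffOn ℝ ∞ (py (px Q.c)) U := (hc.px hU).py hU
  have hA0y : ContDiffOn ℝ ∞ (py Q.A0) U := hA0.py hU
  have hA1x : ContDiffOn ℝ ∞ (px Q.A1) U := hA1.px hU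
  have hA1y : ContDiffOn ℝ ∞ (py Q.A1) U := hA1.py hU
  have hA1yy : ContDiffOn ℝ ∞ (py (py Q.A1)) U := (hA1.py hU).py hU
  unfold Smooth at hc hA0 hA1 hA2 hB4
  have hne : ∀ z ∈ U, 4 * Q.c z * Q.A2 z ≠ 0 := fun z hz ↦ by
    simp [FourthOrder.c, hA z hz]
  exact ContDiffOn.div (by fun_prop) (by fun_prop) hne

/-- The derivative of the root expression along the graph of `y`. -/
def Root.derivLhs (R : Root) (y : ℝ → ℝ) (x : ℝ) : ℝ :=
  iteratedDeriv 3 y x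
    + (graphDeriv R.c y x * deriv y x ^ 3
      + 3 * R.c (x, y x) * deriv y x ^ 2 * iteratedDeriv 2 y x)
    - (graphDeriv R.g y x * deriv y x ^ 2
      + 2 * R.g (x, y x) * deriv y x * iteratedDeriv 2 y x)
    + (graphDeriv R.h y x * deriv y x + R.h (x, y x) * iteratedDeriv 2 y x)
    - graphDeriv R.d y x

/-- The second derivative of the root expression along the graph of `y`. -/
def Root.derivDerivLhs (R : Root) (y : ℝ → ℝ) (x : ℝ) : ℝ :=
  iteratedDeriv 4 y x
    + (graphDeriv₂ R.c y x * deriv y x ^ 3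
      + 6 * graphDeriv R.c y x * deriv y x ^ 2 * iteratedDeriv 2 y x
      + 6 * R.c (x, y x) * deriv y x * iteratedDeriv 2 y x ^ 2
      + 3 * R.c (x, y x) * deriv y x ^ 2 * iteratedDeriv 3 y x)
    - (graphDeriv₂ R.g y x * deriv y x ^ 2
      + 4 * graphDeriv R.g y x * deriv y x * iteratedDeriv 2 y x
      + 2 * R.g (x, y x) * iteratedDeriv 2 y x ^ 2
      + 2 * R.g (x, y x) * deriv y x * iteratedDeriv 3 y x)
    + (graphDeriv₂ R.h y x * deriv y x + 2 * graphDeriv R.h y x * iteratedDeriv 2 y x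
      + R.h (x, y x) * iteratedDeriv 3 y x)
    - graphDeriv₂ R.d y x

theorem Root.SmoothOn.hasDerivAt_lhs (hR : R.SmoothOn U) (hU : IsOpen U) (hI : IsOpen I)
    (hy : ContDiffOn ℝ 3 y I) (hg : GraphIn y I U) (hx : x ∈ I) :
    HasDerivAt (R.lhs y) (R.derivLhs y x) x := by
  have h₀ := hasDerivAt_of_contDiffOn (n := 3) hI hy (by decide) hx
  have h₁ := hasDerivAt_deriv_of_contDiffOn (n := 3) hI hy (by decide) hx
  have h₂ := hasDerivAt_iteratedDeriv_of_contDiffOn (n := 3) hI hy (k := 2) (by decide) hx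
  have hc := (hR.c.hasDerivAt_graph hU h₀ (hg x hx)).mul (h₁.pow 3)
  have hg' := (hR.g.hasDerivAt_graph hU h₀ (hg x hx)).mul (h₁.pow 2)
  have hh := (hR.h.hasDerivAt_graph hU h₀ (hg x hx)).mul h₁
  refine ((((h₂.add hc).sub hg').add hh).sub
    (hR.d.hasDerivAt_graph hU h₀ (hg x hx))).congr_deriv ?_
  simp only [Root.derivLhs, Pi.pow_apply]
  push_cast
  ring

theorem Root.SmoothOn.hasDerivAt_derivLhs (hR : R.SmoothOn U) (hU : IsOpen U) (hI : IsOpen I)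
    (hy : ContDiffOn ℝ 4 y I) (hg : GraphIn y I U) (hx : x ∈ I) :
    HasDerivAt (R.derivLhs y) (R.derivDerivLhs y x) x := by
  have h₀ := hasDerivAt_of_contDiffOn (n := 4) hI hy (by decide) hx
  have h₁ := hasDerivAt_deriv_of_contDiffOn (n := 4) hI hy (by decide) hx
  have h₂ := hasDerivAt_iteratedDeriv_of_contDiffOn (n := 4) hI hy (k := 2) (by decide) hx
  have h₃ := hasDerivAt_iteratedDeriv_of_contDiffOn (n := 4) hI hy (k := 3) (by decide) hx
  have hgraph {F : ℝ × ℝ → ℝ} (hF : Smooth F U) := hF.hasDerivAt_graph hU h₀ (hg x hx)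
  have hgraph' {F : ℝ × ℝ → ℝ} (hF : Smooth F U) := hF.hasDerivAt_graphDeriv hU h₀ h₁ (hg x hx)
  have hc := ((hgraph' hR.c).mul (h₁.pow 3)).add
    ((((hgraph hR.c).const_mul 3).mul (h₁.pow 2)).mul h₂)
  have hg' := ((hgraph' hR.g).mul (h₁.pow 2)).add ((((hgraph hR.g).const_mul 2).mul h₁).mul h₂)
  have hh := ((hgraph' hR.h).mul h₁).add ((hgraph hR.h).mul h₂)
  refine ((((h₃.add hc).sub hg').add hh).sub (hgraph' hR.d)).congr_deriv ?_
  simp only [Root.derivDerivLhs, Pi.pow_apply, Pi.mul_apply]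
  push_cast
  ring

theorem Root.SmoothOn.iteratedDeriv_two_lhs (hR : R.SmoothOn U) (hU : IsOpen U) (hI : IsOpen I)
    (hy : ContDiffOn ℝ 4 y I) (hg : GraphIn y I U) (hx : x ∈ I) :
    iteratedDeriv 2 (R.lhs y) x = R.derivDerivLhs y x := by
  have h : deriv (R.lhs y) =ᶠ[𝓝 x] R.derivLhs y := by
    filter_upwards [hI.mem_nhds hx] with s hs using
      (hR.hasDerivAt_lhs hU hI (hy.of_le (by norm_num)) hg hs).deriv
  rw [iteratedDeriv_succ, iteratedDeriv_one, h.deriv_eq,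
    (hR.hasDerivAt_derivLhs hU hI hy hg hx).deriv]

theorem px_const_mul (k : ℝ) (F : ℝ × ℝ → ℝ) : px (fun z ↦ k * F z) = fun z ↦ k * px F z :=
  funext fun _ ↦ deriv_const_mul_field k

theorem py_const_mul (k : ℝ) (F : ℝ × ℝ → ℝ) : py (fun z ↦ k * F z) = fun z ↦ k * py F z :=
  funext fun _ ↦ deriv_const_mul_field k

theorem FourthOrder.root_g_eq (Q : FourthOrder) : Q.root.g = fun z ↦ 1 / 2 * Q.A1 z :=
  funext fun z ↦ by simp only [FourthOrder.root]; ring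

theorem FourthOrder.A2_eq (Q : FourthOrder) (z : ℝ × ℝ) : Q.A2 z = 3 * Q.c z := by
  simp only [FourthOrder.c]; ring

theorem FourthOrder.B4_eq {z : ℝ × ℝ} (hA : Q.A2 z ≠ 0) :
    Q.B4 z = Q.d z * (4 * Q.c z * Q.A2 z) + 8 * Q.c z * Q.A1 z * Q.A0 z + Q.A1 z ^ 3 / 4
      - 3 * Q.A1 z * px Q.c z + 7 * Q.A0 z * py Q.c z - 2 * Q.c z * px Q.A1 z
      + 5 / 4 * Q.A1 z * py Q.A1 z + 3 * Q.c z * py Q.A0 z - 2 * py (px Q.c) z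
      + py (py Q.A1) z / 2 := by
  have hne : 4 * Q.c z * Q.A2 z ≠ 0 := by simp [FourthOrder.c, hA]
  rw [FourthOrder.d, div_mul_cancel₀ _ hne]
  ring

theorem FourthOrder.iteratedDeriv_two_of_root_lhs_eq_zero (h : Q.root.lhs y x = 0) :
    iteratedDeriv 2 y x = -(Q.c (x, y x) * deriv y x ^ 3) + Q.A1 (x, y x) / 2 * deriv y x ^ 2
      - Q.A0 (x, y x) * deriv y x + Q.d (x, y x) := by
  simp only [Root.lhs, FourthOrder.root] at h
  linarith

theorem FourthOrder.Constraints.lhs_eq (hcon : Q.Constraints U)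
    (hA : ∀ z ∈ U, Q.A2 z ≠ 0) (hx : (x, y x) ∈ U) (h : Q.root.lhs y x = 0) :
    Q.lhs y x = Q.root.derivDerivLhs y x := by
  simp only [FourthOrder.lhs, Root.derivDerivLhs, graphDeriv, graphDeriv₂, Q.root_g_eq,
    px_const_mul, py_const_mul]
  simp only [FourthOrder.root, Q.iteratedDeriv_two_of_root_lhs_eq_zero h, B4_eq (hA _ hx),
    hcon.b7 _ hx, hcon.b6 _ hx, hcon.b5 _ hx, hcon.b3 _ hx, hcon.b2 _ hx, hcon.b1 _ hx,
    hcon.b0 _ hx, Q.A2_eq]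
  ring

theorem FourthOrder.Constraints.arisesFrom (hcon : Q.Constraints U)
    (hU : IsOpen U) (hQ : Q.SmoothOn U) (hA : ∀ z ∈ U, Q.A2 z ≠ 0) : Q.ArisesFrom Q.root U := by
  intro I y hI hy hg x hx h
  rw [(hQ.root hU hA).iteratedDeriv_two_lhs hU hI hy hg hx, hcon.lhs_eq hA (hg x hx) h]

theorem Root.SmoothOn.contDiffOn_succ_of_lhs_eq_zero (hR : R.SmoothOn U) (hI : IsOpen I) {n : ℕ}
    (hn : n ≠ 0) (hy : ContDiffOn ℝ (n + 1) y I) (hg : GraphIn y I U)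
    (h : ∀ x ∈ I, R.lhs y x = 0) : ContDiffOn ℝ (n + 1 + 1) y I := by
  have hyn : ContDiffOn ℝ n y I := hy.of_le (by exact_mod_cast Nat.le_succ n)
  obtain ⟨hd, -, hy'⟩ := (contDiffOn_succ_iff_deriv_of_isOpen hI).1 hy
  have hcoef {F : ℝ × ℝ → ℝ} (hF : Smooth F U) : ContDiffOn ℝ n (fun x ↦ F (x, y x)) I :=
    (ContDiffOn.of_le hF (by exact_mod_cast le_top)).comp (contDiffOn_id.prodMk hyn) hg
  have hy'' : ContDiffOn ℝ n (deriv (deriv y)) I := by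
    have hc := hcoef hR.c
    have hgc := hcoef hR.g
    have hh := hcoef hR.h
    have hdc := hcoef hR.d
    refine ContDiffOn.congr (f := fun x ↦ R.d (x, y x) - R.h (x, y x) * deriv y x
      + R.g (x, y x) * deriv y x ^ 2 - R.c (x, y x) * deriv y x ^ 3) (by fun_prop) fun x hx ↦ ?_
    have hxx := h x hx
    rw [Root.lhs, iteratedDeriv_succ, iteratedDeriv_one] at hxx
    linarith
  have hdd : DifferentiableOn ℝ (deriv y) I := hy'.differentiableOn (by exact_mod_cast hn)
  exact (contDiffOn_succ_iff_deriv_of_isOpen hI).2 ⟨hd, by simp,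
    (contDiffOn_succ_iff_deriv_of_isOpen hI).2 ⟨hdd, by simp, hy''⟩⟩

theorem Root.IsSolution.contDiffOn_four (h : R.IsSolution U I y) (hR : R.SmoothOn U)
    (hI : IsOpen I) : ContDiffOn ℝ 4 y I := by
  obtain ⟨hy, hg, hlhs⟩ := h
  have h3 := hR.contDiffOn_succ_of_lhs_eq_zero (n := 1) hI one_ne_zero
    (by simpa [one_add_one_eq_two] using hy) hg hlhs
  have h4 := hR.contDiffOn_succ_of_lhs_eq_zero (n := 2) hI two_ne_zero
    (by convert h3 using 1; norm_num) hg hlhs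
  convert h4 using 1
  norm_num

theorem FourthOrder.Constraints.isSolution (hcon : Q.Constraints U)
    (hU : IsOpen U) (hQ : Q.SmoothOn U) (hA : ∀ z ∈ U, Q.A2 z ≠ 0) (hI : IsOpen I)
    (h : Q.root.IsSolution U I y) : Q.IsSolution U I y := by
  have hy := h.contDiffOn_four (hQ.root hU hA) hI
  obtain ⟨-, hg, hlhs⟩ := h
  refine ⟨hy, hg, fun x hx ↦ ?_⟩
  have h0 : Q.root.lhs y =ᶠ[𝓝 x] 0 := by
    filter_upwards [hI.mem_nhds hx] with s hs using hlhs s hs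
  rw [hcon.arisesFrom hU hQ hA I y hI hy hg x hx (hlhs x hx), h0.iteratedDeriv_eq]
  simp

end TwiceDifferentiatedRoot

section Reparametrization

variable {u φ ψ φ₁ ψ₁ φ₂ ψ₂ : ℝ → ℝ} {I : Set ℝ} {x : ℝ}

theorem hasDerivAt_of_comp_eq {φ' ψ' : ℝ} (hφ : HasStrictDerivAt φ φ' x)
    (hφ' : φ' ≠ 0) (hψ : HasDerivAt ψ ψ' x) (hu : ∀ᶠ s in 𝓝 x, u (φ s) = ψ s) :
    HasDerivAt u (ψ' / φ') (φ x) := by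
  have hf := hφ.hasStrictFDerivAt_equiv hφ'
  set e := hf.toOpenPartialHomeomorph φ
  have hg : HasDerivAt e.symm φ'⁻¹ (φ x) := (hφ.to_localInverse hφ').hasDerivAt
  have hgx : e.symm (φ x) = x := e.left_inv hf.mem_toOpenPartialHomeomorph_source
  have ht : Tendsto e.symm (𝓝 (φ x)) (𝓝 x) := by
    simpa only [ContinuousAt, hgx] using hg.continuousAt
  have hcomp : HasDerivAt (ψ ∘ e.symm) (ψ' * φ'⁻¹) (φ x) :=
    HasDerivAt.comp (φ x) (by rwa [hgx]) hg
  rw [div_eq_mul_inv]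
  refine hcomp.congr_of_eventuallyEq ?_
  filter_upwards [ht.eventually hu,
    e.open_target.mem_nhds hf.image_mem_toOpenPartialHomeomorph_target] with t hut hte
  have hφt : φ (e.symm t) = t := e.right_inv hte
  rw [Function.comp_apply, ← hut, hφt]

theorem iteratedDeriv_two_of_comp_eq (hI : IsOpen I) (hφ : ∀ x ∈ I, HasDerivAt φ (φ₁ x) x)
    (hφ₁ : ∀ x ∈ I, HasDerivAt φ₁ (φ₂ x) x) (hψ : ∀ x ∈ I, HasDerivAt ψ (ψ₁ x) x)
    (hψ₁ : ∀ x ∈ I, HasDerivAt ψ₁ (ψ₂ x) x) (hne : ∀ x ∈ I, φ₁ x ≠ 0)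
    (hu : ∀ x ∈ I, u (φ x) = ψ x) (hx : x ∈ I) :
    iteratedDeriv 2 u (φ x) = (ψ₂ x * φ₁ x - ψ₁ x * φ₂ x) / φ₁ x ^ 3 := by
  have hstrict : ∀ s ∈ I, HasStrictDerivAt φ (φ₁ s) s := fun s hs ↦
    hasStrictDerivAt_of_hasDerivAt_of_continuousAt
      (eventually_of_mem (hI.mem_nhds hs) hφ) (hφ₁ s hs).continuousAt
  have hu₁ : ∀ s ∈ I, deriv u (φ s) = ψ₁ s / φ₁ s := fun s hs ↦
    (hasDerivAt_of_comp_eq (hstrict s hs) (hne s hs) (hψ s hs)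
      (eventually_of_mem (hI.mem_nhds hs) hu)).deriv
  have hu₂ := (hasDerivAt_of_comp_eq (hstrict x hx) (hne x hx)
    ((hψ₁ x hx).div (hφ₁ x hx) (hne x hx)) (eventually_of_mem (hI.mem_nhds hx) hu₁)).deriv
  rw [iteratedDeriv_succ, iteratedDeriv_one, hu₂, div_div, ← pow_succ]

end Reparametrization

/-- `X` is an affine function on `V` for the connection with Christoffel symbols
`-a, -b, -c, -d, -e, -f`: its covariant Hessian vanishes. -/
structure Geometry.IsAffineOn (G : Geometry) (R : Root) (X : ℝ × ℝ → ℝ) (V : Set (ℝ × ℝ)) :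
    Prop where
  smooth : Smooth X V
  xx : ∀ z ∈ V, px (px X) z = -(G.a z * px X z + R.d z * py X z)
  xy : ∀ z ∈ V, py (px X) z = -(G.b z * px X z + G.e z * py X z)
  yy : ∀ z ∈ V, py (py X) z = -(R.c z * px X z + G.f z * py X z)

/-- The unparametrized geodesics over `V` are the solutions of the root equation `R`. -/
structure Geometry.ProjectsTo (G : Geometry) (R : Root) (V : Set (ℝ × ℝ)) : Prop where
  h : ∀ z ∈ V, R.h z = G.a z - 2 * G.e z
  g : ∀ z ∈ V, R.g z = G.f z - 2 * G.b z

/-- The Jacobian determinant of `(X, Y)`. -/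
def jacobian (X Y : ℝ × ℝ → ℝ) (z : ℝ × ℝ) : ℝ :=
  px X z * py Y z - py X z * px Y z

/-- Affine functions `X`, `Y` that together form a coordinate system on `V`. -/
structure Geometry.IsAffineChart (G : Geometry) (R : Root) (X Y : ℝ × ℝ → ℝ)
    (V : Set (ℝ × ℝ)) : Prop where
  affine_X : G.IsAffineOn R X V
  affine_Y : G.IsAffineOn R Y V
  inj : InjOn (fun z ↦ (X z, Y z)) V
  jacobian_ne_zero : ∀ z ∈ V, jacobian X Y z ≠ 0

/-- The logarithmic rate at which the velocity of an affine function decays along a graph that is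
an unparametrized geodesic. -/
def Geometry.decayRate (G : Geometry) (R : Root) (y : ℝ → ℝ) (x : ℝ) : ℝ :=
  G.a (x, y x) + 2 * G.b (x, y x) * deriv y x + R.c (x, y x) * deriv y x ^ 2

section AlongGraphs

variable {G : Geometry} {R : Root} {X Y : ℝ × ℝ → ℝ} {V W : Set (ℝ × ℝ)} {I : Set ℝ}
  {y u : ℝ → ℝ} {x : ℝ} {z : ℝ × ℝ}

theorem Geometry.IsAffineOn.mono (h : G.IsAffineOn R X W) (hV : V ⊆ W) : G.IsAffineOn R X V :=
  ⟨h.smooth.mono hV, fun z hz ↦ h.xx z (hV hz), fun z hz ↦ h.xy z (hV hz),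
    fun z hz ↦ h.yy z (hV hz)⟩

theorem Smooth.hasPartialsAt_linear_combination (hX : Smooth X V) (hY : Smooth Y V)
    (hV : IsOpen V) (hz : z ∈ V) (k l : ℝ) :
    HasPartialsAt (fun w ↦ k * X w + l * Y w) (k * px X z + l * px Y z)
      (k * py X z + l * py Y z) z :=
  ((hX.hasPartialsAt hV hz).const_mul k).add ((hY.hasPartialsAt hV hz).const_mul l)

theorem Geometry.IsAffineOn.linear_combination (hX : G.IsAffineOn R X V)
    (hY : G.IsAffineOn R Y V) (hV : IsOpen V) (k l : ℝ) :
    G.IsAffineOn R (fun z ↦ k * X z + l * Y z) V := by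
  have h := fun z (hz : z ∈ V) ↦ hX.smooth.hasPartialsAt_linear_combination hY.smooth hV hz k l
  have hpx := fun z (hz : z ∈ V) ↦
    ((hX.smooth.px hV).hasPartialsAt_linear_combination (hY.smooth.px hV) hV hz k l).congr_of_eqOn
      hV (fun w hw ↦ (h w hw).px_eq) hz
  have hpy := fun z (hz : z ∈ V) ↦
    ((hX.smooth.py hV).hasPartialsAt_linear_combination (hY.smooth.py hV) hV hz k l).congr_of_eqOn
      hV (fun w hw ↦ (h w hw).py_eq) hz
  refine ⟨(hX.smooth.const_mul k).add (hY.smooth.const_mul l), fun z hz ↦ ?_, fun z hz ↦ ?_,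
    fun z hz ↦ ?_⟩
  · rw [(hpx z hz).px_eq, (h z hz).px_eq, (h z hz).py_eq, hX.xx z hz, hY.xx z hz]
    ring
  · rw [(hpx z hz).py_eq, (h z hz).px_eq, (h z hz).py_eq, hX.xy z hz, hY.xy z hz]
    ring
  · rw [(hpy z hz).py_eq, (h z hz).px_eq, (h z hz).py_eq, hX.yy z hz, hY.yy z hz]
    ring

theorem Geometry.IsAffineOn.hasDerivAt_graph (hX : G.IsAffineOn R X V) (hV : IsOpen V)
    (hI : IsOpen I) (hy : ContDiffOn ℝ 2 y I) (hg : GraphIn y I V) (hx : x ∈ I) :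
    HasDerivAt (fun s ↦ X (s, y s)) (graphDeriv X y x) x :=
  hX.smooth.hasDerivAt_graph hV (hasDerivAt_of_contDiffOn (n := 2) hI hy (by decide) hx) (hg x hx)

theorem Geometry.IsAffineOn.hasDerivAt_graphDeriv (hX : G.IsAffineOn R X V) (hV : IsOpen V)
    (hG : G.ProjectsTo R V) (hI : IsOpen I) (hy : ContDiffOn ℝ 2 y I) (hg : GraphIn y I V)
    (hx : x ∈ I) : HasDerivAt (graphDeriv X y)
      (-G.decayRate R y x * graphDeriv X y x + py X (x, y x) * R.lhs y x) x := by
  have h₀ := hasDerivAt_of_contDiffOn (n := 2) hI hy (by decide) hx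
  have h₁ := hasDerivAt_deriv_of_contDiffOn (n := 2) hI hy (by decide) hx
  refine (hX.smooth.hasDerivAt_graphDeriv hV h₀ h₁ (hg x hx)).congr_deriv ?_
  rw [graphDeriv₂, hX.xx _ (hg x hx), hX.xy _ (hg x hx), hX.yy _ (hg x hx)]
  simp only [Root.lhs, graphDeriv, decayRate, hG.h _ (hg x hx), hG.g _ (hg x hx)]
  ring

theorem jacobian_eq_graphDeriv (X Y : ℝ × ℝ → ℝ) (y : ℝ → ℝ) (x : ℝ) :
    jacobian X Y (x, y x)
      = graphDeriv X y x * py Y (x, y x) - graphDeriv Y y x * py X (x, y x) := by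
  simp only [jacobian, graphDeriv]
  ring

theorem Geometry.IsAffineChart.iteratedDeriv_two_eq (hXY : G.IsAffineChart R X Y V)
    (hV : IsOpen V) (hG : G.ProjectsTo R V) (hI : IsOpen I) (hy : ContDiffOn ℝ 2 y I)
    (hg : GraphIn y I V) (hne : ∀ x ∈ I, graphDeriv X y x ≠ 0)
    (hu : ∀ x ∈ I, u (X (x, y x)) = Y (x, y x)) (hx : x ∈ I) :
    iteratedDeriv 2 u (X (x, y x))
      = jacobian X Y (x, y x) * R.lhs y x / graphDeriv X y x ^ 3 := by
  rw [iteratedDeriv_two_of_comp_eq hI (fun s hs ↦ hXY.affine_X.hasDerivAt_graph hV hI hy hg hs)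
    (fun s hs ↦ hXY.affine_X.hasDerivAt_graphDeriv hV hG hI hy hg hs)
    (fun s hs ↦ hXY.affine_Y.hasDerivAt_graph hV hI hy hg hs)
    (fun s hs ↦ hXY.affine_Y.hasDerivAt_graphDeriv hV hG hI hy hg hs) hne hu hx,
    jacobian_eq_graphDeriv]
  ring

-- The quotient `w ^ 2 / N` is constant.
theorem eq_zero_of_hasDerivAt_mul {w N k : ℝ → ℝ} (hI : IsOpen I) (hc : IsPreconnected I)
    (hw : ∀ x ∈ I, HasDerivAt w (k x * w x) x) (hN : ∀ x ∈ I, HasDerivAt N (2 * k x * N x) x)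
    (hN₀ : ∀ x ∈ I, N x ≠ 0) {x₀ : ℝ} (hx₀ : x₀ ∈ I) (hwx₀ : w x₀ = 0) (hx : x ∈ I) :
    w x = 0 := by
  set κ : ℝ → ℝ →L[ℝ] ℝ := fun x ↦ ContinuousLinearMap.toSpanSingleton ℝ (2 * k x)
  have hw2 : ∀ x ∈ I, HasFDerivAt (fun x ↦ w x ^ 2) (w x ^ 2 • κ x) x := fun x hx ↦
    ((hw x hx).pow 2).hasFDerivAt.congr_fderiv (by ext; simp [κ]; ring)
  have hN2 : ∀ x ∈ I, HasFDerivAt N (N x • κ x) x := fun x hx ↦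
    (hN x hx).hasFDerivAt.congr_fderiv (by ext; simp [κ]; ring)
  have h := mul_eq_mul_of_hasFDerivAt_smul hI hc hw2 hN2 hN₀ hx hx₀
  simpa [hwx₀, hN₀ x₀ hx₀] using h

theorem Geometry.IsAffineChart.sq_graphDeriv_add_sq_graphDeriv_ne_zero
    (hXY : G.IsAffineChart R X Y V) (hx : (x, y x) ∈ V) :
    graphDeriv X y x ^ 2 + graphDeriv Y y x ^ 2 ≠ 0 := fun h ↦ by
  obtain ⟨hX, hY⟩ := (add_eq_zero_iff_of_nonneg (sq_nonneg _) (sq_nonneg _)).1 h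
  refine hXY.jacobian_ne_zero _ hx ?_
  rw [jacobian_eq_graphDeriv, pow_eq_zero_iff two_ne_zero |>.1 hX,
    pow_eq_zero_iff two_ne_zero |>.1 hY]
  ring

theorem Geometry.IsAffineChart.exists_line_of_lhs_eq_zero (hXY : G.IsAffineChart R X Y V)
    (hV : IsOpen V) (hG : G.ProjectsTo R V) (hI : IsOpen I) (hc : IsPreconnected I)
    (hy : ContDiffOn ℝ 2 y I) (hg : GraphIn y I V) (h : ∀ x ∈ I, R.lhs y x = 0) :
    ∃ k l m : ℝ, (k ≠ 0 ∨ l ≠ 0) ∧ ∀ x ∈ I, k * X (x, y x) + l * Y (x, y x) = m := by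
  rcases I.eq_empty_or_nonempty with rfl | ⟨x₀, hx₀⟩
  · exact ⟨1, 0, 0, by simp⟩
  have hvel {Z : ℝ × ℝ → ℝ} (hZ : G.IsAffineOn R Z V) (x : ℝ) (hx : x ∈ I) :
      HasDerivAt (graphDeriv Z y) (-G.decayRate R y x * graphDeriv Z y x) x := by
    simpa only [h x hx, mul_zero, add_zero] using hZ.hasDerivAt_graphDeriv hV hG hI hy hg hx
  set k := graphDeriv Y y x₀ with hk
  set l := -graphDeriv X y x₀ with hl
  have hkl : k ≠ 0 ∨ l ≠ 0 := by
    by_contra! hcon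
    refine hXY.sq_graphDeriv_add_sq_graphDeriv_ne_zero (hg x₀ hx₀) ?_
    rw [neg_eq_zero.1 hcon.2, ← hk, hcon.1]
    norm_num
  set Z : ℝ × ℝ → ℝ := fun z ↦ k * X z + l * Y z
  have hZ : G.IsAffineOn R Z V := hXY.affine_X.linear_combination hXY.affine_Y hV k l
  have hZ₀ : graphDeriv Z y x₀ = 0 := by
    have hp := hXY.affine_X.smooth.hasPartialsAt_linear_combination hXY.affine_Y.smooth hV
      (hg x₀ hx₀) k l
    rw [graphDeriv, hp.px_eq, hp.py_eq, hk, hl, graphDeriv, graphDeriv]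
    ring
  have hZ' : ∀ x ∈ I, graphDeriv Z y x = 0 := fun x hx ↦
    eq_zero_of_hasDerivAt_mul hI hc (hvel hZ) (fun x hx ↦
      (((hvel hXY.affine_X x hx).pow 2).add ((hvel hXY.affine_Y x hx).pow 2)).congr_deriv
        (by simp only [Pi.add_apply, Pi.pow_apply]; push_cast; ring))
      (fun x hx ↦ hXY.sq_graphDeriv_add_sq_graphDeriv_ne_zero (hg x hx)) hx₀ hZ₀ hx
  have hd : ∀ x ∈ I, HasDerivAt (fun s ↦ Z (s, y s)) 0 x := fun x hx ↦
    (hZ.hasDerivAt_graph hV hI hy hg hx).congr_deriv (hZ' x hx)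
  exact ⟨k, l, Z (x₀, y x₀), hkl, fun x hx ↦ hI.is_const_of_deriv_eq_zero hc
    (fun s hs ↦ (hd s hs).differentiableAt.differentiableWithinAt) (fun s hs ↦ (hd s hs).deriv)
    hx hx₀⟩

theorem Geometry.IsAffineOn.lhs_eq_zero_of_const (hX : G.IsAffineOn R X V) (hV : IsOpen V)
    (hG : G.ProjectsTo R V) (hI : IsOpen I) (hy : ContDiffOn ℝ 2 y I) (hg : GraphIn y I V)
    {m : ℝ} (hm : ∀ x ∈ I, X (x, y x) = m) (hx : x ∈ I)
    (hne : px X (x, y x) ≠ 0 ∨ py X (x, y x) ≠ 0) : R.lhs y x = 0 := by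
  have hvel : ∀ s ∈ I, graphDeriv X y s = 0 := fun s hs ↦ by
    have h : (fun s ↦ X (s, y s)) =ᶠ[𝓝 s] fun _ ↦ m := eventually_of_mem (hI.mem_nhds hs) hm
    rw [← (hX.hasDerivAt_graph hV hI hy hg hs).deriv, h.deriv_eq, deriv_const]
  have hpy : py X (x, y x) ≠ 0 := fun h₀ ↦ by
    have hpx := hvel x hx
    rw [graphDeriv, h₀, zero_mul, add_zero] at hpx
    exact hne.elim (· hpx) (· h₀)
  have hacc := (hX.hasDerivAt_graphDeriv hV hG hI hy hg hx).deriv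
  have h : graphDeriv X y =ᶠ[𝓝 x] fun _ ↦ 0 := eventually_of_mem (hI.mem_nhds hx) hvel
  rw [h.deriv_eq, deriv_const, hvel x hx, mul_zero, zero_add] at hacc
  exact (mul_eq_zero.1 hacc.symm).resolve_left hpy

theorem Geometry.IsAffineChart.lhs_eq_zero_of_line (hXY : G.IsAffineChart R X Y V)
    (hV : IsOpen V) (hG : G.ProjectsTo R V) (hI : IsOpen I) (hy : ContDiffOn ℝ 2 y I)
    (hg : GraphIn y I V) {k l m : ℝ} (hkl : k ≠ 0 ∨ l ≠ 0)
    (hm : ∀ x ∈ I, k * X (x, y x) + l * Y (x, y x) = m) (hx : x ∈ I) : R.lhs y x = 0 := by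
  refine (hXY.affine_X.linear_combination hXY.affine_Y hV k l).lhs_eq_zero_of_const hV hG hI hy
    hg hm hx ?_
  have hp := hXY.affine_X.smooth.hasPartialsAt_linear_combination hXY.affine_Y.smooth hV
    (hg x hx) k l
  rw [hp.px_eq, hp.py_eq]
  by_contra! hcon
  have hk : k * jacobian X Y (x, y x) = 0 := by
    rw [jacobian]
    linear_combination py Y (x, y x) * hcon.1 - px Y (x, y x) * hcon.2
  have hl : l * jacobian X Y (x, y x) = 0 := by
    rw [jacobian]
    linear_combination px X (x, y x) * hcon.2 - py X (x, y x) * hcon.1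
  have hJ := hXY.jacobian_ne_zero _ (hg x hx)
  exact hkl.elim (· ((mul_eq_zero.1 hk).resolve_right hJ))
    (· ((mul_eq_zero.1 hl).resolve_right hJ))

theorem Geometry.IsAffineChart.linearizedBy (hXY : G.IsAffineChart R X Y V) (hV : IsOpen V)
    (hG : G.ProjectsTo R V) : R.LinearizedBy X Y V where
  point := ⟨hXY.affine_X.smooth, hXY.affine_Y.smooth, hXY.inj, hXY.jacobian_ne_zero⟩
  equiv I y u hI hy hg hne hu x hx := by
    have hne' : ∀ s ∈ I, graphDeriv X y s ≠ 0 := fun s hs ↦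
      (hXY.affine_X.hasDerivAt_graph hV hI hy hg hs).deriv ▸ hne s hs
    rw [hXY.iteratedDeriv_two_eq hV hG hI hy hg hne' hu hx]
    simp [hXY.jacobian_ne_zero _ (hg x hx), hne' x hx]
  lines _ _ hI hc hy hg := ⟨hXY.exists_line_of_lhs_eq_zero hV hG hI hc hy hg,
    fun ⟨_, _, _, hkl, hm⟩ _ hx ↦ hXY.lhs_eq_zero_of_line hV hG hI hy hg hkl hm hx⟩

end AlongGraphs

section InverseFunction

variable {X Y : ℝ × ℝ → ℝ} {V : Set (ℝ × ℝ)} {z : ℝ × ℝ}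

theorem injective_of_det_ne_zero {α β γ δ : ℝ} (h : α * δ - β * γ ≠ 0) :
    Function.Injective ((ContinuousLinearMap.fst ℝ ℝ ℝ).smulRight (α, γ)
      + (ContinuousLinearMap.snd ℝ ℝ ℝ).smulRight (β, δ)) := by
  rw [injective_iff_map_eq_zero]
  rintro ⟨s, t⟩ hst
  have h₁ : s * α + t * β = 0 := congrArg Prod.fst hst
  have h₂ : s * γ + t * δ = 0 := congrArg Prod.snd hst
  have hs : (α * δ - β * γ) * s = 0 := by linear_combination δ * h₁ - β * h₂
  have ht : (α * δ - β * γ) * t = 0 := by linear_combination α * h₂ - γ * h₁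
  exact Prod.ext ((mul_eq_zero.1 hs).resolve_left h) ((mul_eq_zero.1 ht).resolve_left h)

theorem exists_injOn_of_jacobian_ne_zero (hV : IsOpen V) (hX : Smooth X V) (hY : Smooth Y V)
    (hz : z ∈ V) (hJ : jacobian X Y z ≠ 0) :
    ∃ V' : Set (ℝ × ℝ), IsOpen V' ∧ z ∈ V' ∧ InjOn (fun z ↦ (X z, Y z)) V' := by
  set e := (LinearEquiv.ofInjectiveEndo _ (injective_of_det_ne_zero hJ)).toContinuousLinearEquiv
  have hp : HasPartialsAt (fun z ↦ (X z, Y z)) (px X z, px Y z) (py X z, py Y z) z :=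
    ((hX.hasPartialsAt hV hz).prodMk (hY.hasPartialsAt hV hz)).congr_fderiv (by ext <;> simp)
  have hf : HasStrictFDerivAt (fun z ↦ (X z, Y z)) (e : ℝ × ℝ →L[ℝ] ℝ × ℝ) z :=
    ((hX.contDiffAt hV hz).prodMk (hY.contDiffAt hV hz)).hasStrictFDerivAt'
      (HasFDerivAt.congr_fderiv hp (by ext <;> rfl)) (by simp)
  exact ⟨_, (hf.toOpenPartialHomeomorph _).open_source, hf.mem_toOpenPartialHomeomorph_source,
    (hf.toOpenPartialHomeomorph _).injOn⟩

end InverseFunction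

/-- The connection with Christoffel symbols `-a, -b, -c, -d, -e, -f` is smooth on `W` and flat. -/
structure Geometry.IsFlatOn (G : Geometry) (R : Root) (W : Set (ℝ × ℝ)) : Prop where
  root : R.SmoothOn W
  a : Smooth G.a W
  b : Smooth G.b W
  e : Smooth G.e W
  f : Smooth G.f W
  flat1 : ∀ z ∈ W, py G.a z - px G.b z + G.b z * G.e z - R.c z * R.d z = 0
  flat2 : ∀ z ∈ W, py G.b z - px R.c z + (G.a z * R.c z - G.b z ^ 2)
    + (G.b z * G.f z - R.c z * G.e z) = 0
  flat3 : ∀ z ∈ W, py R.d z - px G.e z - (G.a z * G.e z - G.b z * R.d z)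
    - (R.d z * G.f z - G.e z ^ 2) = 0
  flat4 : ∀ z ∈ W, px G.b z + px G.f z = py G.a z + py G.e z

section CompFst

variable {F : ℝ × ℝ → ℝ} {W : Set (ℝ × ℝ)} {E : Type*} [NormedAddCommGroup E] [NormedSpace ℝ E]

theorem Smooth.hasFDerivAt_comp_fst (hF : Smooth F W) (hW : IsOpen W) {w : (ℝ × ℝ) × E}
    (hw : w.1 ∈ W) :
    HasFDerivAt (fun p : (ℝ × ℝ) × E ↦ F p.1) (((ContinuousLinearMap.fst ℝ ℝ ℝ).smulRight
      (px F w.1) + (ContinuousLinearMap.snd ℝ ℝ ℝ).smulRight (py F w.1)).comp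
      (ContinuousLinearMap.fst ℝ (ℝ × ℝ) E)) w :=
  HasFDerivAt.comp w (hF.hasPartialsAt hW hw) hasFDerivAt_fst

theorem Smooth.contDiffOn_comp_fst (hF : Smooth F W) :
    ContDiffOn ℝ ∞ (fun p : (ℝ × ℝ) × E ↦ F p.1) (W ×ˢ univ) :=
  ContDiffOn.comp hF contDiffOn_fst fun _ hp ↦ hp.1

end CompFst

section Flat

variable {G : Geometry} {R : Root} {U V W : Set (ℝ × ℝ)} {X Y : ℝ × ℝ → ℝ} {z : ℝ × ℝ}

theorem Root.SmoothOn.mono (h : R.SmoothOn U) (hW : W ⊆ U) : R.SmoothOn W :=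
  ⟨h.c.mono hW, h.g.mono hW, h.h.mono hW, h.d.mono hW⟩

theorem Geometry.Consistent.isFlatOn (h : G.Consistent R W) (hW : IsOpen W) (hR : R.SmoothOn W) :
    G.IsFlatOn R W := by
  obtain ⟨ha, hb, he, hf, -, -, -⟩ := h.smooth
  refine ⟨hR, ha, hb, he, hf, h.flat1, h.flat2, h.flat3, fun z hz ↦ ?_⟩
  rw [← ((hb.hasPartialsAt hW hz).add (hf.hasPartialsAt hW hz)).px_eq,
    ← ((ha.hasPartialsAt hW hz).add (he.hasPartialsAt hW hz)).py_eq]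
  exact h.flat4 z hz

/-- The `x`-derivative of `(X, X_x, X_y)` prescribed by the equation of an affine function `X`. -/
def Geometry.affineRhsX (G : Geometry) (R : Root) (p : (ℝ × ℝ) × (ℝ × ℝ × ℝ)) : ℝ × ℝ × ℝ :=
  (p.2.2.1, -(G.a p.1 * p.2.2.1 + R.d p.1 * p.2.2.2), -(G.b p.1 * p.2.2.1 + G.e p.1 * p.2.2.2))

/-- The `y`-derivative of `(X, X_x, X_y)` prescribed by the equation of an affine function `X`. -/
def Geometry.affineRhsY (G : Geometry) (R : Root) (p : (ℝ × ℝ) × (ℝ × ℝ × ℝ)) : ℝ × ℝ × ℝ :=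
  (p.2.2.2, -(G.b p.1 * p.2.2.1 + G.e p.1 * p.2.2.2), -(R.c p.1 * p.2.2.1 + G.f p.1 * p.2.2.2))

theorem Geometry.IsFlatOn.contDiffOn_affineRhsX (h : G.IsFlatOn R W) :
    ContDiffOn ℝ ∞ (G.affineRhsX R) (W ×ˢ univ) := by
  have ha := h.a.contDiffOn_comp_fst (E := ℝ × ℝ × ℝ)
  have hb := h.b.contDiffOn_comp_fst (E := ℝ × ℝ × ℝ)
  have hd := h.root.d.contDiffOn_comp_fst (E := ℝ × ℝ × ℝ)
  have he := h.e.contDiffOn_comp_fst (E := ℝ × ℝ × ℝ)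
  unfold affineRhsX
  fun_prop

theorem Geometry.IsFlatOn.contDiffOn_affineRhsY (h : G.IsFlatOn R W) :
    ContDiffOn ℝ ∞ (G.affineRhsY R) (W ×ˢ univ) := by
  have hb := h.b.contDiffOn_comp_fst (E := ℝ × ℝ × ℝ)
  have hc := h.root.c.contDiffOn_comp_fst (E := ℝ × ℝ × ℝ)
  have he := h.e.contDiffOn_comp_fst (E := ℝ × ℝ × ℝ)
  have hf := h.f.contDiffOn_comp_fst (E := ℝ × ℝ × ℝ)
  unfold affineRhsY
  fun_prop

-- Flatness is the integrability condition of the equation for affine functions.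
theorem Geometry.IsFlatOn.affineRhs_compatible (h : G.IsFlatOn R W) (hW : IsOpen W)
    {w : (ℝ × ℝ) × (ℝ × ℝ × ℝ)} (hw : w.1 ∈ W) :
    fderiv ℝ (G.affineRhsX R) w ((0, 1), G.affineRhsY R w)
      = fderiv ℝ (G.affineRhsY R) w ((1, 0), G.affineRhsX R w) := by
  have ha := h.a.hasFDerivAt_comp_fst hW hw
  have hb := h.b.hasFDerivAt_comp_fst hW hw
  have hc := h.root.c.hasFDerivAt_comp_fst hW hw
  have hd := h.root.d.hasFDerivAt_comp_fst hW hw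
  have he := h.e.hasFDerivAt_comp_fst hW hw
  have hf := h.f.hasFDerivAt_comp_fst hW hw
  have hs : HasFDerivAt (fun p : (ℝ × ℝ) × (ℝ × ℝ × ℝ) ↦ p.2.2.1) _ w :=
    (hasFDerivAt_id (𝕜 := ℝ) w).snd.snd.fst
  have ht : HasFDerivAt (fun p : (ℝ × ℝ) × (ℝ × ℝ × ℝ) ↦ p.2.2.2) _ w :=
    (hasFDerivAt_id (𝕜 := ℝ) w).snd.snd.snd
  have hX : HasFDerivAt (G.affineRhsX R) _ w := hs.prodMk
    (((ha.mul hs).add (hd.mul ht)).neg.prodMk ((hb.mul hs).add (he.mul ht)).neg)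
  have hY : HasFDerivAt (G.affineRhsY R) _ w := ht.prodMk
    (((hb.mul hs).add (he.mul ht)).neg.prodMk ((hc.mul hs).add (hf.mul ht)).neg)
  rw [hX.fderiv, hY.fderiv]
  simp only [affineRhsX, affineRhsY, ContinuousLinearMap.comp_id, ContinuousLinearMap.add_comp,
    smul_add, neg_add_rev, ContinuousLinearMap.prod_apply, ContinuousLinearMap.comp_apply,
    ContinuousLinearMap.coe_snd', ContinuousLinearMap.coe_fst', add_apply, neg_apply, smul_apply,
    ContinuousLinearMap.smulRight_apply, smul_eq_mul, one_mul, zero_mul, mul_zero, neg_zero,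
    add_zero, zero_add, Prod.mk.injEq, true_and]
  constructor
  · linear_combination (-w.2.2.1) * h.flat1 _ hw - w.2.2.2 * h.flat3 _ hw
  · linear_combination (-w.2.2.1) * h.flat2 _ hw + w.2.2.2 * (h.flat1 _ hw + h.flat4 _ hw)

theorem Geometry.IsFlatOn.exists_isAffineOn (h : G.IsFlatOn R W) (hW : IsOpen W) (hz : z ∈ W)
    (α β : ℝ) : ∃ (V : Set (ℝ × ℝ)) (X : ℝ × ℝ → ℝ), IsOpen V ∧ z ∈ V ∧ V ⊆ W ∧
      G.IsAffineOn R X V ∧ px X z = α ∧ py X z = β := by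
  obtain ⟨V, hV, hzV, v, hvz, hvs, hv⟩ := exists_solution_total_differential
    (hW.prod isOpen_univ) h.contDiffOn_affineRhsX h.contDiffOn_affineRhsY
    (fun w hw ↦ h.affineRhs_compatible hW hw.1) (z₀ := z) (v₀ := (0, α, β)) ⟨hz, mem_univ _⟩
  have hX : ∀ w ∈ V, HasPartialsAt (fun w ↦ (v w).1) (v w).2.1 (v w).2.2 w := fun w hw ↦
    (HasFDerivAt.fst (hv w hw).2).congr_fderiv (by ext <;> simp [affineRhsX, affineRhsY])
  have hX₁ : ∀ w ∈ V, HasPartialsAt (px fun w ↦ (v w).1)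
      (-(G.a w * (v w).2.1 + R.d w * (v w).2.2)) (-(G.b w * (v w).2.1 + G.e w * (v w).2.2)) w :=
    fun w hw ↦ HasPartialsAt.congr_of_eqOn (F := fun w ↦ (v w).2.1)
      ((HasFDerivAt.fst (HasFDerivAt.snd (hv w hw).2)).congr_fderiv
        (by ext <;> simp [affineRhsX, affineRhsY])) hV (fun s hs ↦ (hX s hs).px_eq) hw
  have hX₂ : ∀ w ∈ V, HasPartialsAt (py fun w ↦ (v w).1)
      (-(G.b w * (v w).2.1 + G.e w * (v w).2.2)) (-(R.c w * (v w).2.1 + G.f w * (v w).2.2)) w :=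
    fun w hw ↦ HasPartialsAt.congr_of_eqOn (F := fun w ↦ (v w).2.2)
      ((HasFDerivAt.snd (HasFDerivAt.snd (hv w hw).2)).congr_fderiv
        (by ext <;> simp [affineRhsX, affineRhsY])) hV (fun s hs ↦ (hX s hs).py_eq) hw
  refine ⟨V, fun w ↦ (v w).1, hV, hzV, fun w hw ↦ (hv w hw).1.1,
    ⟨contDiff_fst.comp_contDiffOn hvs, fun w hw ↦ ?_, fun w hw ↦ ?_, fun w hw ↦ ?_⟩, ?_, ?_⟩
  · rw [(hX₁ w hw).px_eq, (hX w hw).px_eq, (hX w hw).py_eq]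
  · rw [(hX₁ w hw).py_eq, (hX w hw).px_eq, (hX w hw).py_eq]
  · rw [(hX₂ w hw).py_eq, (hX w hw).px_eq, (hX w hw).py_eq]
  · rw [(hX z hzV).px_eq, hvz]
  · rw [(hX z hzV).py_eq, hvz]

theorem Smooth.jacobian (hX : Smooth X V) (hY : Smooth Y V) (hV : IsOpen V) :
    Smooth (jacobian X Y) V :=
  ((hX.px hV).mul (hY.py hV)).sub ((hX.py hV).mul (hY.px hV))

theorem Geometry.IsFlatOn.exists_isAffineChart (h : G.IsFlatOn R W) (hW : IsOpen W) (hz : z ∈ W)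
    {α β γ δ : ℝ} (hdet : α * δ - β * γ ≠ 0) : ∃ (V : Set (ℝ × ℝ)) (X Y : ℝ × ℝ → ℝ),
      IsOpen V ∧ IsPreconnected V ∧ z ∈ V ∧ V ⊆ W ∧ G.IsAffineChart R X Y V ∧
      px X z = α ∧ py X z = β ∧ px Y z = γ ∧ py Y z = δ := by
  obtain ⟨V₁, X, hV₁, hz₁, hVW, hX, rfl, rfl⟩ := h.exists_isAffineOn hW hz α β
  obtain ⟨V₂, Y, hV₂, hz₂, -, hY, rfl, rfl⟩ := h.exists_isAffineOn hW hz γ δ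
  have hV₁₂ := hV₁.inter hV₂
  replace hX := hX.mono (inter_subset_left (t := V₂))
  replace hY := hY.mono (inter_subset_right (s := V₁))
  obtain ⟨V', hV', hz', hinj⟩ :=
    exists_injOn_of_jacobian_ne_zero hV₁₂ hX.smooth hY.smooth ⟨hz₁, hz₂⟩ hdet
  set O : Set (ℝ × ℝ) := V₁ ∩ V₂ ∩ jacobian X Y ⁻¹' {0}ᶜ ∩ V'
  have hO : IsOpen O := ((hX.smooth.jacobian hY.smooth hV₁₂).continuousOn.isOpen_inter_preimage
    hV₁₂ isOpen_compl_singleton).inter hV'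
  obtain ⟨ρ, hρ, hball⟩ := isOpen_iff.1 hO z ⟨⟨⟨hz₁, hz₂⟩, hdet⟩, hz'⟩
  have hchart : G.IsAffineChart R X Y (ball z ρ) :=
    ⟨hX.mono fun _ hw ↦ (hball hw).1.1, hY.mono fun _ hw ↦ (hball hw).1.1,
      hinj.mono fun _ hw ↦ (hball hw).2, fun _ hw ↦ (hball hw).1.2⟩
  exact ⟨ball z ρ, X, Y, isOpen_ball, (convex_ball z ρ).isPreconnected, mem_ball_self hρ,
    fun w hw ↦ hVW (hball hw).1.1.1, hchart, rfl, rfl, rfl, rfl⟩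

end Flat

section Sylvester

theorem exists_sign_mul_sq (k : ℝ) : ∃ s : ℝ, (s = 1 ∨ s = -1) ∧ ∃ α : ℝ, k = s * α ^ 2 := by
  rcases le_total 0 k with hk | hk
  · exact ⟨1, .inl rfl, √k, by rw [Real.sq_sqrt hk, one_mul]⟩
  · exact ⟨-1, .inr rfl, √(-k), by rw [Real.sq_sqrt (neg_nonneg.2 hk), neg_one_mul, neg_neg]⟩

theorem exists_signed_squares_of_ne_zero {p : ℝ} (hp : p ≠ 0) (q r : ℝ) :
    ∃ s t : ℝ, (s = 1 ∨ s = -1) ∧ (t = 1 ∨ t = -1) ∧ ∃ α β γ δ : ℝ,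
      p = s * α ^ 2 + t * γ ^ 2 ∧ q = s * (α * β) + t * (γ * δ) ∧ r = s * β ^ 2 + t * δ ^ 2 := by
  obtain ⟨s, hs, α, rfl⟩ := exists_sign_mul_sq p
  obtain ⟨t, ht, δ, hδ⟩ := exists_sign_mul_sq (r - q ^ 2 / (s * α ^ 2))
  obtain ⟨hs₀, hα₀⟩ := mul_ne_zero_iff.1 hp
  replace hα₀ : α ≠ 0 := fun h ↦ hα₀ (by rw [h, zero_pow two_ne_zero])
  refine ⟨s, t, hs, ht, α, q / (s * α), 0, δ, by ring, by field_simp; ring, ?_⟩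
  rw [← hδ]
  field_simp
  ring

theorem exists_signed_squares (p q r : ℝ) :
    ∃ s t : ℝ, (s = 1 ∨ s = -1) ∧ (t = 1 ∨ t = -1) ∧ ∃ α β γ δ : ℝ,
      p = s * α ^ 2 + t * γ ^ 2 ∧ q = s * (α * β) + t * (γ * δ) ∧ r = s * β ^ 2 + t * δ ^ 2 := by
  by_cases hp : p = 0
  · by_cases hr : r = 0
    · exact ⟨1, -1, .inl rfl, .inr rfl, 1, q / 2, 1, -q / 2, by rw [hp]; ring, by ring,
        by rw [hr]; ring⟩
    · obtain ⟨s, t, hs, ht, α, β, γ, δ, hα, hαβ, hβ⟩ := exists_signed_squares_of_ne_zero hr q p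
      exact ⟨s, t, hs, ht, β, α, δ, γ, hβ, by rw [hαβ]; ring, hα⟩
  · exact exists_signed_squares_of_ne_zero hp q r

end Sylvester

section Metric

variable {G : Geometry} {R : Root} {V W : Set (ℝ × ℝ)} {X Y Z T : ℝ × ℝ → ℝ} {z z₀ : ℝ × ℝ}

theorem Geometry.IsAffineOn.hasPartialsAt_px (hX : G.IsAffineOn R X V) (hV : IsOpen V)
    (hz : z ∈ V) : HasPartialsAt (px X) (-(G.a z * px X z + R.d z * py X z))
      (-(G.b z * px X z + G.e z * py X z)) z :=
  ((hX.smooth.px hV).hasPartialsAt hV hz).congr_partials (hX.xx z hz) (hX.xy z hz)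

theorem Geometry.IsAffineOn.hasPartialsAt_py (hX : G.IsAffineOn R X V) (hV : IsOpen V)
    (hz : z ∈ V) : HasPartialsAt (py X) (-(G.b z * px X z + G.e z * py X z))
      (-(R.c z * px X z + G.f z * py X z)) z :=
  ((hX.smooth.py hV).hasPartialsAt hV hz).congr_partials
    ((hX.smooth.px_py hV hz).trans (hX.xy z hz)) (hX.yy z hz)

/-- The pairing of `dZ` and `dT` by the adjugate of the metric matrix. It is used instead of the
inverse metric because it is polynomial in the coefficients. -/
def Geometry.adjugatePairing (G : Geometry) (Z T : ℝ × ℝ → ℝ) (z : ℝ × ℝ) : ℝ :=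
  G.p z * (py Z z * py T z) - G.q z * (px Z z * py T z + py Z z * px T z)
    + G.r z * (px Z z * px T z)

/-- The logarithmic derivative of a parallel scalar density of weight two. -/
def Geometry.densityForm (G : Geometry) (z : ℝ × ℝ) : ℝ × ℝ →L[ℝ] ℝ :=
  (ContinuousLinearMap.fst ℝ ℝ ℝ).smulRight (-2 * (G.a z + G.e z))
    + (ContinuousLinearMap.snd ℝ ℝ ℝ).smulRight (-2 * (G.b z + G.f z))

theorem Geometry.Consistent.hasFDerivAt_adjugatePairing (h : G.Consistent R V) (hV : IsOpen V)
    (hZ : G.IsAffineOn R Z V) (hT : G.IsAffineOn R T V) (hz : z ∈ V) :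
    HasFDerivAt (G.adjugatePairing Z T) (G.adjugatePairing Z T z • G.densityForm z) z := by
  obtain ⟨-, -, -, -, hp, hq, hr⟩ := h.smooth
  have hp := (hp.hasPartialsAt hV hz).congr_partials (h.p_x z hz) (h.p_y z hz)
  have hq := (hq.hasPartialsAt hV hz).congr_partials (h.q_x z hz) (h.q_y z hz)
  have hr := (hr.hasPartialsAt hV hz).congr_partials (h.r_x z hz) (h.r_y z hz)
  have hZx := hZ.hasPartialsAt_px hV hz
  have hZy := hZ.hasPartialsAt_py hV hz
  have hTx := hT.hasPartialsAt_px hV hz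
  have hTy := hT.hasPartialsAt_py hV hz
  have hN := ((hp.mul (hZy.mul hTy)).sub (hq.mul ((hZx.mul hTy).add (hZy.mul hTx)))).add
    (hr.mul (hZx.mul hTx))
  refine HasFDerivAt.congr_fderiv hN ?_
  ext <;> simp [adjugatePairing, densityForm] <;> ring

theorem Geometry.IsAffineChart.hasFDerivAt_sq_jacobian (hXY : G.IsAffineChart R X Y V)
    (hV : IsOpen V) (hz : z ∈ V) :
    HasFDerivAt (fun w ↦ jacobian X Y w ^ 2) (jacobian X Y z ^ 2 • G.densityForm z) z := by
  have hXx := hXY.affine_X.hasPartialsAt_px hV hz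
  have hXy := hXY.affine_X.hasPartialsAt_py hV hz
  have hYx := hXY.affine_Y.hasPartialsAt_px hV hz
  have hYy := hXY.affine_Y.hasPartialsAt_py hV hz
  have hJ : HasFDerivAt (jacobian X Y) _ z := (hXx.mul hYy).sub (hXy.mul hYx)
  refine (hJ.pow 2).congr_fderiv ?_
  ext <;> simp [jacobian, densityForm] <;> ring

-- The coefficients of a parallel metric with respect to affine coordinates are constant.
theorem Geometry.IsAffineChart.adjugatePairing_mul_sq_jacobian (hXY : G.IsAffineChart R X Y V)
    (h : G.Consistent R V) (hV : IsOpen V) (hc : IsPreconnected V) (hZ : G.IsAffineOn R Z V)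
    (hT : G.IsAffineOn R T V) (hz : z ∈ V) (hz₀ : z₀ ∈ V) :
    G.adjugatePairing Z T z * jacobian X Y z₀ ^ 2
      = G.adjugatePairing Z T z₀ * jacobian X Y z ^ 2 :=
  mul_eq_mul_of_hasFDerivAt_smul hV hc (fun _ hw ↦ h.hasFDerivAt_adjugatePairing hV hZ hT hw)
    (fun _ hw ↦ hXY.hasFDerivAt_sq_jacobian hV hw)
    (fun w hw ↦ pow_ne_zero 2 (hXY.jacobian_ne_zero w hw)) hz hz₀

/-- The metric is `s dX² + t dY²` at `z`. -/
def Geometry.IsSumSqAt (G : Geometry) (s t : ℝ) (X Y : ℝ × ℝ → ℝ) (z : ℝ × ℝ) : Prop :=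
  G.p z = s * px X z ^ 2 + t * px Y z ^ 2 ∧
    G.q z = s * (px X z * py X z) + t * (px Y z * py Y z) ∧
    G.r z = s * py X z ^ 2 + t * py Y z ^ 2

theorem Geometry.isSumSqAt_iff {s t : ℝ} (hJ : jacobian X Y z ≠ 0) :
    G.IsSumSqAt s t X Y z ↔ G.adjugatePairing Y Y z = s * jacobian X Y z ^ 2 ∧
      G.adjugatePairing X Y z = 0 ∧ G.adjugatePairing X X z = t * jacobian X Y z ^ 2 := by
  constructor
  · rintro ⟨hp, hq, hr⟩
    simp only [adjugatePairing, jacobian, hp, hq, hr]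
    refine ⟨?_, ?_, ?_⟩ <;> ring
  · rintro ⟨hY, hXY, hX⟩
    have hJ2 := pow_ne_zero 2 hJ
    simp only [adjugatePairing, jacobian] at hY hXY hX hJ2
    refine ⟨mul_left_cancel₀ hJ2 ?_, mul_left_cancel₀ hJ2 ?_, mul_left_cancel₀ hJ2 ?_⟩
    · linear_combination px X z ^ 2 * hY - 2 * px X z * px Y z * hXY + px Y z ^ 2 * hX
    · linear_combination px X z * py X z * hY - (px X z * py Y z + py X z * px Y z) * hXY
        + px Y z * py Y z * hX
    · linear_combination py X z ^ 2 * hY - 2 * py X z * py Y z * hXY + py Y z ^ 2 * hX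

theorem Geometry.IsAffineChart.isSumSqAt (hXY : G.IsAffineChart R X Y V) (h : G.Consistent R V)
    (hV : IsOpen V) (hc : IsPreconnected V) {s t : ℝ} (hz₀ : z₀ ∈ V)
    (h₀ : G.IsSumSqAt s t X Y z₀) (hz : z ∈ V) : G.IsSumSqAt s t X Y z := by
  have hJ₀ := hXY.jacobian_ne_zero z₀ hz₀
  obtain ⟨hYY, hXY₀, hXX⟩ := (isSumSqAt_iff hJ₀).1 h₀
  have hconst {Z T : ℝ × ℝ → ℝ} (hZ : G.IsAffineOn R Z V) (hT : G.IsAffineOn R T V) {k : ℝ}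
      (hk : G.adjugatePairing Z T z₀ = k * jacobian X Y z₀ ^ 2) :
      G.adjugatePairing Z T z = k * jacobian X Y z ^ 2 := by
    refine mul_right_cancel₀ (pow_ne_zero 2 hJ₀) ?_
    rw [hXY.adjugatePairing_mul_sq_jacobian h hV hc hZ hT hz hz₀, hk]
    ring
  refine (isSumSqAt_iff (hXY.jacobian_ne_zero z hz)).2
    ⟨hconst hXY.affine_Y hXY.affine_Y hYY, ?_, hconst hXY.affine_X hXY.affine_X hXX⟩
  rw [hconst hXY.affine_X hXY.affine_Y (k := 0) (by rw [hXY₀, zero_mul]), zero_mul]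

theorem Geometry.Consistent.projectsTo (h : G.Consistent R W) : G.ProjectsTo R W :=
  ⟨h.proj_h, h.proj_g⟩

theorem Geometry.Consistent.mono (h : G.Consistent R W) (hV : V ⊆ W) : G.Consistent R V := by
  obtain ⟨ha, hb, he, hf, hp, hq, hr⟩ := h.smooth
  exact ⟨⟨ha.mono hV, hb.mono hV, he.mono hV, hf.mono hV, hp.mono hV, hq.mono hV, hr.mono hV⟩,
    fun z hz ↦ h.proj_h z (hV hz), fun z hz ↦ h.proj_g z (hV hz), fun z hz ↦ h.flat1 z (hV hz),
    fun z hz ↦ h.flat2 z (hV hz), fun z hz ↦ h.flat3 z (hV hz), fun z hz ↦ h.flat4 z (hV hz),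
    fun z hz ↦ h.p_x z (hV hz), fun z hz ↦ h.q_x z (hV hz), fun z hz ↦ h.r_x z (hV hz),
    fun z hz ↦ h.p_y z (hV hz), fun z hz ↦ h.q_y z (hV hz), fun z hz ↦ h.r_y z (hV hz),
    fun z hz ↦ h.nondeg z (hV hz)⟩

theorem Geometry.Consistent.exists_isCartesian (h : G.Consistent R W) (hW : IsOpen W)
    (hR : R.SmoothOn W) (hz : z ∈ W) : ∃ (V : Set (ℝ × ℝ)) (X Y : ℝ × ℝ → ℝ),
      IsOpen V ∧ z ∈ V ∧ V ⊆ W ∧ G.IsCartesian X Y V ∧ R.LinearizedBy X Y V := by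
  obtain ⟨s, t, hs, ht, α, β, γ, δ, hp, hq, hr⟩ := exists_signed_squares (G.p z) (G.q z) (G.r z)
  have hdet : α * δ - β * γ ≠ 0 := fun h₀ ↦ h.nondeg z hz <| by
    rw [hp, hq, hr]
    linear_combination s * t * (α * δ - β * γ) * h₀
  obtain ⟨V, X, Y, hV, hc, hzV, hVW, hXY, rfl, rfl, rfl, rfl⟩ :=
    (h.isFlatOn hW hR).exists_isAffineChart hW hz hdet
  replace h := h.mono hVW
  exact ⟨V, X, Y, hV, hzV, hVW,
    ⟨s, t, hs, ht, fun w hw ↦ hXY.isSumSqAt h hV hc hzV ⟨hp, hq, hr⟩ hw⟩,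
    hXY.linearizedBy hV h.projectsTo⟩

end Metric

section FlatLift

variable {G : Geometry} {R : Root} {U V W : Set (ℝ × ℝ)} {X Y b e : ℝ × ℝ → ℝ} {z : ℝ × ℝ}

/-- The part of `b_x` free of `b` and `e` in the system `Root.IsFlatLift`. -/
def Root.freeTermBX (R : Root) (z : ℝ × ℝ) : ℝ :=
  -1 / 3 * py R.h z + -2 / 3 * px R.g z + R.c z * R.d z

/-- The part of `b_y` free of `b` and `e` in the system `Root.IsFlatLift`. -/
def Root.freeTermBY (R : Root) (z : ℝ × ℝ) : ℝ :=
  px R.c z - R.c z * R.h z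

/-- The part of `e_x` free of `b` and `e` in the system `Root.IsFlatLift`. -/
def Root.freeTermEX (R : Root) (z : ℝ × ℝ) : ℝ :=
  py R.d z - R.d z * R.g z

/-- The part of `e_y` free of `b` and `e` in the system `Root.IsFlatLift`. -/
def Root.freeTermEY (R : Root) (z : ℝ × ℝ) : ℝ :=
  -2 / 3 * py R.h z + -1 / 3 * px R.g z + R.c z * R.d z

/-- The system for the two coefficients `b, e` that remain free in a connection whose geodesics
project to `R`: with `a = h + 2 e` and `f = g + 2 b`, it is the flatness of the connection solved
for the first derivatives of `b` and `e`. -/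
structure Root.IsFlatLift (R : Root) (b e : ℝ × ℝ → ℝ) (V : Set (ℝ × ℝ)) : Prop where
  b_smooth : Smooth b V
  e_smooth : Smooth e V
  b_partials : ∀ z ∈ V, HasPartialsAt b (R.freeTermBX z - b z * e z)
    (R.freeTermBY z - R.c z * e z - b z * b z - R.g z * b z) z
  e_partials : ∀ z ∈ V, HasPartialsAt e (R.freeTermEX z - R.h z * e z - e z * e z - R.d z * b z)
    (R.freeTermEY z - b z * e z) z

/-- The right-hand side of the `x`-derivatives in `Root.IsFlatLift`. -/
def Root.flatLiftRhsX (R : Root) (p : (ℝ × ℝ) × (ℝ × ℝ)) : ℝ × ℝ :=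
  (R.freeTermBX p.1 - p.2.1 * p.2.2,
    R.freeTermEX p.1 - R.h p.1 * p.2.2 - p.2.2 * p.2.2 - R.d p.1 * p.2.1)

/-- The right-hand side of the `y`-derivatives in `Root.IsFlatLift`. -/
def Root.flatLiftRhsY (R : Root) (p : (ℝ × ℝ) × (ℝ × ℝ)) : ℝ × ℝ :=
  (R.freeTermBY p.1 - R.c p.1 * p.2.2 - p.2.1 * p.2.1 - R.g p.1 * p.2.1,
    R.freeTermEY p.1 - p.2.1 * p.2.2)

theorem Root.SmoothOn.freeTermBX (hR : R.SmoothOn U) (hU : IsOpen U) : Smooth R.freeTermBX U :=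
  (((hR.h.py hU).const_mul _).add ((hR.g.px hU).const_mul _)).add (hR.c.mul hR.d)

theorem Root.SmoothOn.freeTermBY (hR : R.SmoothOn U) (hU : IsOpen U) : Smooth R.freeTermBY U :=
  (hR.c.px hU).sub (hR.c.mul hR.h)

theorem Root.SmoothOn.freeTermEX (hR : R.SmoothOn U) (hU : IsOpen U) : Smooth R.freeTermEX U :=
  (hR.d.py hU).sub (hR.d.mul hR.g)

theorem Root.SmoothOn.freeTermEY (hR : R.SmoothOn U) (hU : IsOpen U) : Smooth R.freeTermEY U :=
  (((hR.h.py hU).const_mul _).add ((hR.g.px hU).const_mul _)).add (hR.c.mul hR.d)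

theorem Root.SmoothOn.py_freeTermBX (hR : R.SmoothOn U) (hU : IsOpen U) (hz : z ∈ U) :
    py R.freeTermBX z = -1 / 3 * py (py R.h) z + -2 / 3 * py (px R.g) z
      + (py R.c z * R.d z + R.c z * py R.d z) :=
  (((hR.h.py hU).hasPartialsAt_linear_combination (hR.g.px hU) hU hz _ _).add
    ((hR.c.hasPartialsAt hU hz).mul (hR.d.hasPartialsAt hU hz))).py_eq

theorem Root.SmoothOn.px_freeTermBY (hR : R.SmoothOn U) (hU : IsOpen U) (hz : z ∈ U) :
    px R.freeTermBY z = px (px R.c) z - px (fun w ↦ R.c w * R.h w) z :=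
  (((hR.c.px hU).hasPartialsAt hU hz).sub
    (Smooth.hasPartialsAt (F := fun w ↦ R.c w * R.h w) (hR.c.mul hR.h) hU hz)).px_eq

theorem Root.SmoothOn.py_freeTermEX (hR : R.SmoothOn U) (hU : IsOpen U) (hz : z ∈ U) :
    py R.freeTermEX z = py (py R.d) z - py (fun w ↦ R.d w * R.g w) z :=
  (((hR.d.py hU).hasPartialsAt hU hz).sub
    (Smooth.hasPartialsAt (F := fun w ↦ R.d w * R.g w) (hR.d.mul hR.g) hU hz)).py_eq

theorem Root.SmoothOn.px_freeTermEY (hR : R.SmoothOn U) (hU : IsOpen U) (hz : z ∈ U) :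
    px R.freeTermEY z = -2 / 3 * py (px R.h) z + -1 / 3 * px (px R.g) z
      + (px R.c z * R.d z + R.c z * px R.d z) := by
  rw [← hR.h.px_py hU hz]
  exact (((hR.h.py hU).hasPartialsAt_linear_combination (hR.g.px hU) hU hz _ _).add
    ((hR.c.hasPartialsAt hU hz).mul (hR.d.hasPartialsAt hU hz))).px_eq

theorem Root.SmoothOn.contDiffOn_flatLiftRhsX (hR : R.SmoothOn U) (hU : IsOpen U) :
    ContDiffOn ℝ ∞ R.flatLiftRhsX (U ×ˢ univ) := by
  have hBX := (hR.freeTermBX hU).contDiffOn_comp_fst (E := ℝ × ℝ)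
  have hEX := (hR.freeTermEX hU).contDiffOn_comp_fst (E := ℝ × ℝ)
  have hh := hR.h.contDiffOn_comp_fst (E := ℝ × ℝ)
  have hd := hR.d.contDiffOn_comp_fst (E := ℝ × ℝ)
  unfold flatLiftRhsX
  fun_prop

theorem Root.SmoothOn.contDiffOn_flatLiftRhsY (hR : R.SmoothOn U) (hU : IsOpen U) :
    ContDiffOn ℝ ∞ R.flatLiftRhsY (U ×ˢ univ) := by
  have hBY := (hR.freeTermBY hU).contDiffOn_comp_fst (E := ℝ × ℝ)
  have hEY := (hR.freeTermEY hU).contDiffOn_comp_fst (E := ℝ × ℝ)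
  have hc := hR.c.contDiffOn_comp_fst (E := ℝ × ℝ)
  have hg := hR.g.contDiffOn_comp_fst (E := ℝ × ℝ)
  unfold flatLiftRhsY
  fun_prop

-- In the compatibility conditions everything that involves `b` or `e` cancels, and what is left
-- is a multiple of Lie's criteria.
theorem Root.LieCriteria.flatLiftRhs_compatible (hlie : R.LieCriteria U) (hU : IsOpen U)
    (hR : R.SmoothOn U) {w : (ℝ × ℝ) × (ℝ × ℝ)} (hw : w.1 ∈ U) :
    fderiv ℝ R.flatLiftRhsX w ((0, 1), R.flatLiftRhsY w)
      = fderiv ℝ R.flatLiftRhsY w ((1, 0), R.flatLiftRhsX w) := by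
  have hBX := (hR.freeTermBX hU).hasFDerivAt_comp_fst hU hw
  have hBY := (hR.freeTermBY hU).hasFDerivAt_comp_fst hU hw
  have hEX := (hR.freeTermEX hU).hasFDerivAt_comp_fst hU hw
  have hEY := (hR.freeTermEY hU).hasFDerivAt_comp_fst hU hw
  have hc := hR.c.hasFDerivAt_comp_fst hU hw
  have hg := hR.g.hasFDerivAt_comp_fst hU hw
  have hh := hR.h.hasFDerivAt_comp_fst hU hw
  have hd := hR.d.hasFDerivAt_comp_fst hU hw
  have hb : HasFDerivAt (fun p : (ℝ × ℝ) × (ℝ × ℝ) ↦ p.2.1) _ w :=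
    (hasFDerivAt_id (𝕜 := ℝ) w).snd.fst
  have he : HasFDerivAt (fun p : (ℝ × ℝ) × (ℝ × ℝ) ↦ p.2.2) _ w :=
    (hasFDerivAt_id (𝕜 := ℝ) w).snd.snd
  have hX : HasFDerivAt R.flatLiftRhsX _ w := (hBX.sub (hb.mul he)).prodMk
    (((hEX.sub (hh.mul he)).sub (he.mul he)).sub (hd.mul hb))
  have hY : HasFDerivAt R.flatLiftRhsY _ w :=
    (((hBY.sub (hc.mul he)).sub (hb.mul hb)).sub (hg.mul hb)).prodMk (hEY.sub (hb.mul he))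
  rw [hX.fderiv, hY.fderiv]
  simp only [flatLiftRhsX, flatLiftRhsY, hR.py_freeTermBX hU hw, hR.py_freeTermEX hU hw,
    hR.px_freeTermBY hU hw, hR.px_freeTermEY hU hw, ContinuousLinearMap.add_comp,
    ContinuousLinearMap.comp_id, ContinuousLinearMap.prod_apply, ContinuousLinearMap.comp_apply,
    ContinuousLinearMap.coe_fst', ContinuousLinearMap.coe_snd', ContinuousLinearMap.smulRight_apply,
    sub_apply, add_apply, smul_apply, smul_add, smul_eq_mul, zero_mul, one_mul, mul_zero, zero_add,
    add_zero, Prod.mk.injEq]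
  simp only [freeTermBX, freeTermBY, freeTermEX, freeTermEY]
  constructor
  · linear_combination (1 / 3) * hlie.first _ hw
  · linear_combination (-1 / 3) * hlie.second _ hw

theorem Root.LieCriteria.exists_isFlatLift (hlie : R.LieCriteria U) (hU : IsOpen U)
    (hR : R.SmoothOn U) (hz : z ∈ U) : ∃ (V : Set (ℝ × ℝ)) (b e : ℝ × ℝ → ℝ),
      IsOpen V ∧ z ∈ V ∧ V ⊆ U ∧ R.IsFlatLift b e V := by
  obtain ⟨V, hV, hzV, v, -, hvs, hv⟩ := exists_solution_total_differential
    (hU.prod isOpen_univ) (hR.contDiffOn_flatLiftRhsX hU) (hR.contDiffOn_flatLiftRhsY hU)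
    (fun w hw ↦ hlie.flatLiftRhs_compatible hU hR hw.1) (z₀ := z) (v₀ := 0) ⟨hz, mem_univ _⟩
  exact ⟨V, fun w ↦ (v w).1, fun w ↦ (v w).2, hV, hzV, fun w hw ↦ (hv w hw).1.1,
    contDiff_fst.comp_contDiffOn hvs, contDiff_snd.comp_contDiffOn hvs,
    fun w hw ↦ (HasFDerivAt.fst (hv w hw).2).congr_fderiv
      (by ext <;> simp [flatLiftRhsX, flatLiftRhsY]),
    fun w hw ↦ (HasFDerivAt.snd (hv w hw).2).congr_fderiv
      (by ext <;> simp [flatLiftRhsX, flatLiftRhsY])⟩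

/-- The connection with given coefficients `b, e` whose geodesics project to `R`. Its metric
coefficients are placeholders. -/
def Root.lift (R : Root) (b e : ℝ × ℝ → ℝ) : Geometry where
  a := fun w ↦ R.h w + 2 * e w
  b := b
  e := e
  f := fun w ↦ R.g w + 2 * b w
  p := 0
  q := 0
  r := 0

theorem Root.projectsTo_lift (R : Root) (b e : ℝ × ℝ → ℝ) (V : Set (ℝ × ℝ)) :
    (R.lift b e).ProjectsTo R V :=
  ⟨fun _ _ ↦ (add_sub_cancel_right _ _).symm, fun _ _ ↦ (add_sub_cancel_right _ _).symm⟩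

theorem Root.IsFlatLift.isFlatOn (h : R.IsFlatLift b e V) (hV : IsOpen V) (hR : R.SmoothOn V) :
    (R.lift b e).IsFlatOn R V := by
  have ha := fun z (hz : z ∈ V) ↦
    ((hR.h.hasPartialsAt hV hz).add ((h.e_partials z hz).const_mul 2)).py_eq
  have hf := fun z (hz : z ∈ V) ↦
    ((hR.g.hasPartialsAt hV hz).add ((h.b_partials z hz).const_mul 2)).px_eq
  refine ⟨hR, hR.h.add (h.e_smooth.const_mul 2), h.b_smooth, h.e_smooth,
    hR.g.add (h.b_smooth.const_mul 2), fun z hz ↦ ?_, fun z hz ↦ ?_, fun z hz ↦ ?_,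
    fun z hz ↦ ?_⟩ <;> simp only [lift]
  · rw [ha z hz, (h.b_partials z hz).px_eq, freeTermBX, freeTermEY]
    ring
  · rw [(h.b_partials z hz).py_eq, freeTermBY]
    ring
  · rw [(h.e_partials z hz).px_eq, freeTermEX]
    ring
  · rw [ha z hz, hf z hz, (h.b_partials z hz).px_eq, (h.e_partials z hz).py_eq, freeTermBX,
      freeTermEY]
    ring

/-- The connection of `G` equipped with the metric `dX² + dY²`. -/
def Geometry.withSumSq (G : Geometry) (X Y : ℝ × ℝ → ℝ) : Geometry :=
  { G with
    p := fun z ↦ px X z * px X z + px Y z * px Y z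
    q := fun z ↦ px X z * py X z + px Y z * py Y z
    r := fun z ↦ py X z * py X z + py Y z * py Y z }

theorem Geometry.IsFlatOn.mono (h : G.IsFlatOn R W) (hV : V ⊆ W) : G.IsFlatOn R V :=
  ⟨h.root.mono hV, h.a.mono hV, h.b.mono hV, h.e.mono hV, h.f.mono hV,
    fun z hz ↦ h.flat1 z (hV hz), fun z hz ↦ h.flat2 z (hV hz), fun z hz ↦ h.flat3 z (hV hz),
    fun z hz ↦ h.flat4 z (hV hz)⟩

theorem Geometry.IsAffineChart.consistent_withSumSq (hXY : G.IsAffineChart R X Y V)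
    (hV : IsOpen V) (h : G.IsFlatOn R V) (hG : G.ProjectsTo R V) :
    (G.withSumSq X Y).Consistent R V := by
  have hXx := fun z (hz : z ∈ V) ↦ hXY.affine_X.hasPartialsAt_px hV hz
  have hXy := fun z (hz : z ∈ V) ↦ hXY.affine_X.hasPartialsAt_py hV hz
  have hYx := fun z (hz : z ∈ V) ↦ hXY.affine_Y.hasPartialsAt_px hV hz
  have hYy := fun z (hz : z ∈ V) ↦ hXY.affine_Y.hasPartialsAt_py hV hz
  have hp := fun z (hz : z ∈ V) ↦
    ((hXx z hz).mul (hXx z hz)).add ((hYx z hz).mul (hYx z hz))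
  have hq := fun z (hz : z ∈ V) ↦
    ((hXx z hz).mul (hXy z hz)).add ((hYx z hz).mul (hYy z hz))
  have hr := fun z (hz : z ∈ V) ↦
    ((hXy z hz).mul (hXy z hz)).add ((hYy z hz).mul (hYy z hz))
  have sXx := hXY.affine_X.smooth.px hV
  have sXy := hXY.affine_X.smooth.py hV
  have sYx := hXY.affine_Y.smooth.px hV
  have sYy := hXY.affine_Y.smooth.py hV
  refine
    { smooth := ⟨h.a, h.b, h.e, h.f, (sXx.mul sXx).add (sYx.mul sYx),
        (sXx.mul sXy).add (sYx.mul sYy), (sXy.mul sXy).add (sYy.mul sYy)⟩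
      proj_h := hG.h
      proj_g := hG.g
      flat1 := h.flat1
      flat2 := h.flat2
      flat3 := h.flat3
      flat4 := fun z hz ↦ ?_
      p_x := fun z hz ↦ (hp z hz).px_eq.trans ?_
      q_x := fun z hz ↦ (hq z hz).px_eq.trans ?_
      r_x := fun z hz ↦ (hr z hz).px_eq.trans ?_
      p_y := fun z hz ↦ (hp z hz).py_eq.trans ?_
      q_y := fun z hz ↦ (hq z hz).py_eq.trans ?_
      r_y := fun z hz ↦ (hr z hz).py_eq.trans ?_
      nondeg := fun z hz h₀ ↦ pow_ne_zero 2 (hXY.jacobian_ne_zero z hz) (.trans ?_ h₀) }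
  · exact ((h.b.hasPartialsAt hV hz).add (h.f.hasPartialsAt hV hz)).px_eq.trans
      ((h.flat4 z hz).trans
        ((h.a.hasPartialsAt hV hz).add (h.e.hasPartialsAt hV hz)).py_eq.symm)
  all_goals
    simp only [withSumSq, jacobian]
    ring

theorem Root.LieCriteria.exists_consistent (hlie : R.LieCriteria U) (hU : IsOpen U)
    (hR : R.SmoothOn U) (hz : z ∈ U) : ∃ (W : Set (ℝ × ℝ)) (G : Geometry),
      IsOpen W ∧ z ∈ W ∧ W ⊆ U ∧ G.Consistent R W := by
  obtain ⟨V, b, e, hV, hzV, hVU, hbe⟩ := hlie.exists_isFlatLift hU hR hz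
  have hflat : (R.lift b e).IsFlatOn R V := hbe.isFlatOn hV (hR.mono hVU)
  obtain ⟨W, X, Y, hW, -, hzW, hWV, hXY, -⟩ :=
    hflat.exists_isAffineChart hV hzV (α := 1) (β := 0) (γ := 0) (δ := 1) (by norm_num)
  exact ⟨W, (R.lift b e).withSumSq X Y, hW, hzW, hWV.trans hVU,
    hXY.consistent_withSumSq hW (hflat.mono hWV) (R.projectsTo_lift b e W)⟩

end FlatLift

end CondLin

end

theorem theorem3 (U : Set (ℝ × ℝ)) (hU : IsOpen U) (Q : CondLin.FourthOrder)
    (hQ : Q.SmoothOn U) (hA : ∀ z ∈ U, Q.A2 z ≠ 0)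
    (hcon : Q.Constraints U) (hlie : Q.root.LieCriteria U) :
    Q.ConditionallyLinearizable Q.root U ∧
    (∀ z ∈ U, ∃ (W : Set (ℝ × ℝ)) (G : CondLin.Geometry),
      IsOpen W ∧ z ∈ W ∧ W ⊆ U ∧ G.Consistent Q.root W) ∧
    (∀ (W : Set (ℝ × ℝ)) (G : CondLin.Geometry), IsOpen W → W ⊆ U → G.Consistent Q.root W →
      ∀ z ∈ W, ∃ (V : Set (ℝ × ℝ)) (X Y : ℝ × ℝ → ℝ), IsOpen V ∧ z ∈ V ∧ V ⊆ W ∧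
        G.IsCartesian X Y V ∧ Q.root.LinearizedBy X Y V) := by
  have hR := hQ.root hU hA
  refine ⟨⟨hcon.arisesFrom hU hQ hA, fun _ _ hI h ↦ hcon.isSolution hU hQ hA hI h,
    fun z hz ↦ ?_⟩, fun z hz ↦ hlie.exists_consistent hU hR hz,
    fun W G hW hWU hG z hz ↦ hG.exists_isCartesian hW (hR.mono hWU) hz⟩
  obtain ⟨W, G, hW, hzW, hWU, hG⟩ := hlie.exists_consistent hU hR hz
  obtain ⟨V, X, Y, hV, hzV, hVW, -, hlin⟩ := hG.exists_isCartesian hW (hR.mono hWU) hzW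
  exact ⟨V, X, Y, hV, hzV, hVW.trans hWU, hlin⟩
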